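/- Let $\mathbb{K}$ be the digital line, i.e. $\mathbb{Z}$ with the Khalimsky topology generated by the sets $\{n\}$ for $n$ odd and $\{n-1,n,n+1\}$ for $n$ even, and let $\mathbb{K}^2$ carry the product topology. For $x\in\mathbb{K}^2$ let $N(x)$ be the smallest open set containing $x$, let $cl(x)$ be the closure of $\{x\}$, and let $A(x)=\{y\neq x : \{x,y\}\text{ is connected}\}$ be the set of points adjacent to $x$. A point of $\mathbb{K}^2$ is pure if its coordinates have the same parity, and mixed otherwise. An arc is a subset homeomorphic (in the subspace topology) to a finite interval of $\mathbb{K}$; a Jordan curve is a connected set $J$ with $|J|\ge 4$ such that $J\setminus\{x\}$ is an arc for every $x\in J$. Let $\Gamma:\mathbb{Z}^2\to\mathbb{K}^2$, $\Gamma(x,y)=(x+y,y-x)$, and for $A\subseteq\mathbb{Z}^2$ and $J\subseteq\mathbb{K}^2$ put $$\Gamma^*(A)=\Gamma(A)\cup\{x \text{ mixed} : N(x)\subseteq\Gamma(A)\cup\{x\}\ \text{or}\ cl(x)\subseteq\Gamma(A)\cup\{x\}\},$$ $$A_J=\{x\text{ mixed} : A(x)\subseteq\Gamma(A)\cup J\}.$$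 Two points of $\mathbb{Z}^2$ are 4-adjacent if they differ by $(\pm1,0)$ or $(0,\pm1)$; a subset of $\mathbb{Z}^2$ is 4-connected if it cannot be divided into two nonempty subsets with no point of one 4-adjacent to a point of the other; the 4-components of a set are its maximal 4-connected subsets. Theorem. Let $J$ be a Jordan curve in $\mathbb{K}^2$ with more than four points such that $\Gamma^*(\Gamma^{-1}(J))=J$. Then $\mathbb{K}^2\setminus J$ has exactly two connected components, and every point of $J$ is adjacent to some point of each of them. Moreover, $\mathbb{Z}^2\setminus\Gamma^{-1}(J)$ has exactly two 4-components $A$ and $B$, and the connected components of $\mathbb{K}^2\setminus J$ are $\Gamma^*(A)\cup A_J$ and $\Gamma^*(B)\cup B_J$. -/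

import Mathlib

/-- The underlying set of the digital line: a copy of `ℤ` that does not carry the discrete
topology of `ℤ`. -/
def DigitalLine : Type := ℤ

namespace DigitalLine

/-- The identity, regarded as a map between the integers and the points of the digital line. -/
def ofInt : ℤ ≃ DigitalLine := Equiv.refl ℤ

/-- The integer underlying a point of the digital line. -/
def toInt (n : DigitalLine) : ℤ := ofInt.symm n

/-- The generating sets: `{n}` for `n` odd, `{n - 1, n, n + 1}` for `n` even. -/
def basicNhd (n : ℤ) : Set ℤ := if Odd n then {n} else {n - 1, n, n + 1}

/-- The Khalimsky topology. -/
instance instTopologicalSpace : TopologicalSpace DigitalLine :=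
  TopologicalSpace.generateFrom (Set.range fun n : ℤ => ofInt '' basicNhd n)

/-- The finite interval of the digital line with end points `a` and `b`. -/
def interval (a b : ℤ) : Set DigitalLine := ofInt '' Set.Icc a b

end DigitalLine

/-- The digital plane, with the product of the Khalimsky topologies. -/
abbrev DigitalPlane : Type := DigitalLine × DigitalLine

namespace DigitalTopology

section General

variable {X : Type*} [TopologicalSpace X]

/-- The adjacency `A(x)` of a point `x`. -/
def adjacency (x : X) : Set X := {y | y ≠ x ∧ IsConnected ({x, y} : Set X)}

/-- An arc: a subset that is homeomorphic, in the subspace topology, to a nonempty finite interval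
of the digital line. -/
def IsArc (C : Set X) : Prop :=
  ∃ a b : ℤ, a ≤ b ∧ Nonempty (DigitalLine.interval a b ≃ₜ C)

/-- A Jordan curve. -/
def IsJordanCurve (J : Set X) : Prop :=
  IsConnected J ∧ 4 ≤ J.encard ∧ ∀ x ∈ J, IsArc (J \ {x})

/-- The set of connected components of a subset `S`. -/
def components (S : Set X) : Set (Set X) := connectedComponentIn S '' S

end General

/-- A point of the digital plane is pure if its coordinates are both even or both odd. -/
def IsPure (p : DigitalPlane) : Prop :=
  (Even p.1.toInt ∧ Even p.2.toInt) ∨ (Odd p.1.toInt ∧ Odd p.2.toInt)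

/-- A point of the digital plane is mixed if it is not pure. -/
def IsMixed (p : DigitalPlane) : Prop := ¬ IsPure p

/-- The slant map `Γ(x, y) = (x + y, y - x)`. -/
def slant (p : ℤ × ℤ) : DigitalPlane :=
  (DigitalLine.ofInt (p.1 + p.2), DigitalLine.ofInt (p.2 - p.1))

/-- The operator `Γ*`. In the digital plane, `nhdsKer {x}` (the intersection of all neighbourhoods
of `x`) is the smallest open set `N(x)` containing `x`. -/
def slantStar (A : Set (ℤ × ℤ)) : Set DigitalPlane :=
  slant '' A ∪
    {x | IsMixed x ∧ (nhdsKer {x} ⊆ slant '' A ∪ {x} ∨ closure {x} ⊆ slant '' A ∪ {x})}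

/-- The set `A_J` of the mixed points `x` with `A(x) ⊆ Γ(A) ∪ J`. -/
def mixedFill (A : Set (ℤ × ℤ)) (J : Set DigitalPlane) : Set DigitalPlane :=
  {x | IsMixed x ∧ adjacency x ⊆ slant '' A ∪ J}

/-- `q` is one of the four points of `ℤ²` that are 4-adjacent to `p`. -/
def FourAdj (p q : ℤ × ℤ) : Prop :=
  q = (p.1 + 1, p.2) ∨ q = (p.1 - 1, p.2) ∨ q = (p.1, p.2 + 1) ∨ q = (p.1, p.2 - 1)

/-- `S` is 4-connected if it is not the union of two disjoint nonempty sets that are not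
4-adjacent to each other. -/
def FourConnected (S : Set (ℤ × ℤ)) : Prop :=
  ¬ ∃ A B : Set (ℤ × ℤ), A.Nonempty ∧ B.Nonempty ∧ Disjoint A B ∧ A ∪ B = S ∧
    ∀ p ∈ A, ∀ q ∈ B, ¬ FourAdj p q

/-- The set of 4-components of `S`, that is, of maximal 4-connected subsets of `S`. -/
def fourComponents (S : Set (ℤ × ℤ)) : Set (Set (ℤ × ℤ)) :=
  {C | Maximal (fun T => T ⊆ S ∧ FourConnected T) C}

end DigitalTopology

/-! Through `slant` the pure points become the lattice `ℤ²`, with 4-adjacency as their adjacency,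
and the mixed points become the centres of unit squares, each adjacent exactly to its four corners.
The smallest open set and the closure of a mixed point each pick out one pair of opposite corners.
So `hstar` says that a centre lies on `J` iff its square has two opposite corners in `C = slant ⁻¹'
J`: the mixed points of `J` are the diagonal steps of `C`, and `C` determines `J`. In a Jordan curve
with more than four points every point has exactly two neighbours and no three points are mutually
adjacent. Hence every point of `C` has exactly two 8-neighbours in `C`, and no unit square has three
corners in `C` (`isEightCurve_preimage`).

Separation is a parity argument. A lattice point is coloured by the number modulo 2 of crossings of
`C` with a horizontal ray; since degrees in `C` are even, the colour is constant along 4-paths off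
`C` (`colour_up`, `colour_eq_of_fourAdj`).

That each colour gives a single component is local. Around a point of `C`, both colours occur among
its 4-neighbours (`exists_fourAdj_mem_side`), and 4-neighbours of equal colour are joined off `C`
inside the ring of eight points (`fourJoined_of_colour_eq`). Connectedness of `J` carries these
joins along the whole curve, and every point off `C` can walk to the curve
(`fourJoined_of_mem_side`). Finally, the corners off `C` of a square whose centre is off `J` share
one colour, so the centre joins that side (`squareCentre_mem_region`). -/

open Set

/-! ### Adjacency, specialization and connectedness. -/

namespace DigitalTopology

section General

variable {X : Type*} [TopologicalSpace X]

/-- A two-point subspace is disconnected exactly when each point has an open set missing the other,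
that is, when the points are incomparable for specialization. -/
theorem mem_adjacency_iff {x y : X} : y ∈ adjacency x ↔ y ≠ x ∧ (x ⤳ y ∨ y ⤳ x) := by
  refine and_congr_right fun hne => ⟨fun h => ?_, fun h => ⟨⟨x, by simp⟩, ?_⟩⟩
  · by_contra! hcon
    obtain ⟨h1, h2⟩ := hcon
    rw [specializes_iff_forall_open] at h1 h2
    push Not at h1 h2
    obtain ⟨U, hU, hyU, hxU⟩ := h1
    obtain ⟨V, hV, hxV, hyV⟩ := h2
    obtain ⟨z, hz, hzU, hzV⟩ := h.isPreconnected U V hU hV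
      (by rintro z (rfl | rfl) <;> simp [*]) ⟨y, by simp, hyU⟩ ⟨x, by simp, hxV⟩
    rcases hz with rfl | rfl
    · exact hxU hzU
    · exact hyV hzV
  · rcases h with h | h
    · refine isPreconnected_singleton.subset_closure (s := {x}) (by simp) ?_
      rintro z (rfl | rfl)
      · exact subset_closure rfl
      · exact specializes_iff_mem_closure.1 h
    · refine isPreconnected_singleton.subset_closure (s := {y}) (by simp) ?_
      rintro z (rfl | rfl)
      · exact specializes_iff_mem_closure.1 h
      · exact subset_closure rfl

theorem mem_adjacency_comm {x y : X} : y ∈ adjacency x ↔ x ∈ adjacency y := by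
  rw [mem_adjacency_iff, mem_adjacency_iff, ne_comm, or_comm]

/-- In an Alexandrov-discrete space a predicate that is invariant under adjacency is constant on
preconnected sets. -/
theorem IsPreconnected.of_adjacency_invariant [AlexandrovDiscrete X] {S : Set X}
    (hS : IsPreconnected S) {Q : X → Prop}
    (hQ : ∀ x ∈ S, ∀ y ∈ S, y ∈ adjacency x → Q x → Q y) {x y : X} (hx : x ∈ S) (hy : y ∈ S)
    (hQx : Q x) : Q y := by
  by_contra hQy
  have spec : ∀ u ∈ S, ∀ v ∈ S, u ⤳ v → (Q u ↔ Q v) := by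
    intro u hu v hv h
    by_cases e : u = v
    · rw [e]
    · exact ⟨hQ u hu v hv (mem_adjacency_iff.2 ⟨Ne.symm e, Or.inl h⟩),
        hQ v hv u hu (mem_adjacency_iff.2 ⟨e, Or.inr h⟩)⟩
  -- The smallest open sets around the two classes must meet in `S`; a common point specializes to a
  -- point of each class, and `Q` agrees along both specializations.
  obtain ⟨z, hz, hz1, hz2⟩ := hS (nhdsKer {u | u ∈ S ∧ Q u}) (nhdsKer {u | u ∈ S ∧ ¬ Q u})
    isOpen_nhdsKer isOpen_nhdsKer
    (fun u hu => by
      by_cases h : Q u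
      · exact Or.inl (subset_nhdsKer ⟨hu, h⟩)
      · exact Or.inr (subset_nhdsKer ⟨hu, h⟩))
    ⟨x, hx, subset_nhdsKer ⟨hx, hQx⟩⟩ ⟨y, hy, subset_nhdsKer ⟨hy, hQy⟩⟩
  rw [mem_nhdsKer_iff_specializes] at hz1 hz2
  obtain ⟨u, ⟨hu, hQu⟩, huz⟩ := hz1
  obtain ⟨v, ⟨hv, hQv⟩, hvz⟩ := hz2
  exact hQv ((spec z hz v hv hvz).1 ((spec z hz u hu huz).2 hQu))

/-- Membership in one of two open sets separating `S` would itself be an adjacency-invariant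
predicate. -/
theorem isPreconnected_of_adjacency_invariant {S : Set X}
    (h : ∀ Q : X → Prop, (∀ x ∈ S, ∀ y ∈ S, y ∈ adjacency x → Q x → Q y) →
      ∀ x ∈ S, ∀ y ∈ S, Q x → Q y) : IsPreconnected S := by
  intro U V hU hV hS ⟨x, hx, hxU⟩ ⟨y, hy, hyV⟩
  by_contra hcon
  have hd : ∀ z ∈ S, z ∈ U → z ∉ V := fun z hz h1 h2 => hcon ⟨z, hz, h1, h2⟩
  refine hd y hy (h (· ∈ U) (fun u hu v hv huv huU => ?_) x hx y hy hxU) hyV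
  rcases (mem_adjacency_iff.1 huv).2 with h | h
  · exact (hS hv).resolve_right fun hvV => hd u hu huU (h.mem_open hV hvV)
  · exact h.mem_open hU huU

theorem components_eq_pair [AlexandrovDiscrete X] {S D E : Set X} (hD : IsConnected D)
    (hE : IsConnected E) (hunion : D ∪ E = S) (hdisj : Disjoint D E)
    (hadj : ∀ x ∈ D, ∀ y ∈ E, y ∉ adjacency x) : components S = {D, E} := by
  have key : ∀ D' E' : Set X, IsConnected D' → D' ∪ E' = S →
      (∀ x ∈ D', ∀ y ∈ E', y ∉ adjacency x) → ∀ x ∈ D', connectedComponentIn S x = D' := by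
    intro D' E' h1 h2 h3 x hx
    have hsub : D' ⊆ S := h2 ▸ subset_union_left
    refine Subset.antisymm (fun y hy => ?_)
      (h1.isPreconnected.subset_connectedComponentIn hx hsub)
    refine IsPreconnected.of_adjacency_invariant (Q := (· ∈ D'))
      (isPreconnected_connectedComponentIn (F := S) (x := x)) (fun u hu v hv huv huD => ?_)
      (mem_connectedComponentIn (hsub hx)) hy hx
    have hvS : v ∈ D' ∪ E' := h2 ▸ connectedComponentIn_subset S x hv
    exact hvS.resolve_right fun hvE => h3 u huD v hvE huv
  have hkD := key D E hD hunion hadj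
  have hkE := key E D hE (by rw [union_comm, hunion])
    (fun x hx y hy h => hadj y hy x hx (mem_adjacency_comm.1 h))
  ext T
  constructor
  · rintro ⟨x, hx, rfl⟩
    rw [← hunion] at hx
    rcases hx with hx | hx
    · exact Or.inl (hkD x hx)
    · exact Or.inr (hkE x hx)
  · rintro (rfl | rfl)
    · obtain ⟨x, hx⟩ := hD.nonempty
      exact ⟨x, hunion ▸ Or.inl hx, hkD x hx⟩
    · obtain ⟨x, hx⟩ := hE.nonempty
      exact ⟨x, hunion ▸ Or.inr hx, hkE x hx⟩

end General

end DigitalTopology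

/-! ### The digital line. -/

namespace DigitalLine

theorem mem_basicNhd {a b : ℤ} : b ∈ basicNhd a ↔ b = a ∨ (Even a ∧ (b = a - 1 ∨ b = a + 1)) := by
  unfold basicNhd
  split_ifs with h
  · have : ¬ Even a := Int.not_even_iff_odd.2 h
    simp [this]
  · have : Even a := Int.not_odd_iff_even.1 h
    simp [this]
    tauto

theorem isOpen_basicNhd (a : ℤ) : IsOpen (ofInt '' basicNhd a) :=
  TopologicalSpace.isOpen_generateFrom_of_mem ⟨a, rfl⟩

/-- `basicNhd a` is the smallest open set around `a`: every generator containing `a` contains it,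
and this property passes to intersections and unions. -/
theorem specializes_iff {a b : ℤ} : ofInt b ⤳ ofInt a ↔ b ∈ basicNhd a := by
  constructor
  · intro h
    have := h.mem_open (isOpen_basicNhd a) ⟨a, mem_basicNhd.2 (Or.inl rfl), rfl⟩
    simpa using this
  · intro h
    rw [specializes_iff_forall_open]
    intro s hs
    induction hs with
    | basic s hs =>
      obtain ⟨n, rfl⟩ := hs
      simp only [ofInt.injective.mem_set_image, mem_basicNhd] at h ⊢
      simp only [Int.even_iff] at *
      omega
    | univ => simp
    | inter s t _ _ h1 h2 => exact fun h => ⟨h1 h.1, h2 h.2⟩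
    | sUnion S _ ih => exact fun ⟨s, hs, h⟩ => ⟨s, hs, ih s hs h⟩

instance instAlexandrovDiscrete : AlexandrovDiscrete DigitalLine := by
  refine ⟨fun S hS => ?_⟩
  rw [isOpen_iff_mem_nhds]
  intro x hx
  obtain ⟨a, rfl⟩ := ofInt.surjective x
  refine Filter.mem_of_superset
    ((isOpen_basicNhd a).mem_nhds ⟨a, mem_basicNhd.2 (Or.inl rfl), rfl⟩) ?_
  rintro _ ⟨b, hb, rfl⟩ s hs
  exact (specializes_iff.2 hb).mem_open (hS s hs) (hx s hs)

theorem ofInt_mem_adjacency {a b : ℤ} :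
    ofInt b ∈ DigitalTopology.adjacency (ofInt a) ↔ b = a + 1 ∨ a = b + 1 := by
  rw [DigitalTopology.mem_adjacency_iff, specializes_iff, specializes_iff, mem_basicNhd,
    mem_basicNhd, ofInt.injective.ne_iff]
  simp only [Int.even_iff]
  omega

end DigitalLine

/-! ### Arcs and Jordan curves. -/

namespace DigitalTopology

/-- Deleting the point found here from a Jordan curve leaves an arc that still contains those of the
four given points that lie on the curve, so local questions reduce to consecutive integers. -/
theorem exists_mem_notMem_of_four_lt {X : Type*} {J : Set X} (hcard : 4 < J.encard) (x u v w : X) :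
    ∃ z ∈ J, z ≠ x ∧ z ≠ u ∧ z ≠ v ∧ z ≠ w := by
  by_contra! hcon
  have hsub : J ⊆ {x, u, v, w} := by
    intro z hz
    have := hcon z hz
    simp only [mem_insert_iff, mem_singleton_iff]
    tauto
  classical
  have h4 : ({x, u, v, w} : Set X).encard ≤ 4 := by
    have h := Finset.card_le_four (a := x) (b := u) (c := v) (d := w)
    rw [← Nat.cast_le (α := ℕ∞), ← encard_coe_eq_coe_finsetCard] at h
    simpa using h
  exact absurd ((encard_le_encard hsub).trans h4) (not_le.2 hcard)

section Arc

variable {X : Type*} [TopologicalSpace X]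

/-- An arc is enumerated by a finite interval of integers so that adjacency is adjacency of
integers. -/
theorem IsArc.exists_equiv {C : Set X} (hC : IsArc C) :
    ∃ (a b : ℤ) (h : C ≃ Icc a b), ∀ x y : C,
      (y : X) ∈ adjacency (x : X) ↔ (h y : ℤ) = h x + 1 ∨ (h x : ℤ) = h y + 1 := by
  obtain ⟨a, b, -, ⟨e⟩⟩ := hC
  let i : Icc a b ≃ DigitalLine.interval a b := DigitalLine.ofInt.image (Icc a b)
  refine ⟨a, b, (i.trans e.toEquiv).symm, fun x y => ?_⟩
  obtain ⟨x, rfl⟩ := (i.trans e.toEquiv).surjective x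
  obtain ⟨y, rfl⟩ := (i.trans e.toEquiv).surjective y
  have hs : ∀ u v : Icc a b, ((i.trans e.toEquiv u : C) : X) ⤳ (i.trans e.toEquiv v : C) ↔
      DigitalLine.ofInt (u : ℤ) ⤳ DigitalLine.ofInt (v : ℤ) := by
    intro u v
    rw [← subtype_specializes_iff]
    change e (i u) ⤳ e (i v) ↔ _
    rw [e.isInducing.specializes_iff, subtype_specializes_iff]
    rfl
  rw [Equiv.symm_apply_apply, Equiv.symm_apply_apply, ← DigitalLine.ofInt_mem_adjacency,
    mem_adjacency_iff, mem_adjacency_iff, hs, hs, DigitalLine.ofInt.injective.ne_iff,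
    Subtype.coe_injective.ne_iff, (i.trans e.toEquiv).injective.ne_iff,
    Subtype.coe_injective.ne_iff]

theorem IsArc.finite {C : Set X} (hC : IsArc C) : C.Finite := by
  obtain ⟨a, b, h, -⟩ := hC.exists_equiv
  have : Finite C := Finite.of_equiv _ h.symm
  exact Set.toFinite C

theorem IsArc.exists_mem_adjacency {C : Set X} (hC : IsArc C) {x y : X} (hx : x ∈ C) (hy : y ∈ C)
    (hxy : x ≠ y) : ∃ z ∈ C, z ∈ adjacency x := by
  obtain ⟨a, b, h, hadj⟩ := hC.exists_equiv
  have hne : (h ⟨x, hx⟩ : ℤ) ≠ h ⟨y, hy⟩ := fun e =>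
    hxy (congrArg Subtype.val (h.injective (Subtype.ext e)))
  have h1 := (h ⟨x, hx⟩).2
  have h2 := (h ⟨y, hy⟩).2
  rw [mem_Icc] at h1 h2
  have key : ∀ k (hk : k ∈ Icc a b), k = h ⟨x, hx⟩ + 1 ∨ (h ⟨x, hx⟩ : ℤ) = k + 1 →
      ∃ z ∈ C, z ∈ adjacency x := fun k hk hor =>
    ⟨h.symm ⟨k, hk⟩, (h.symm ⟨k, hk⟩).2, (hadj ⟨x, hx⟩ (h.symm ⟨k, hk⟩)).2 (by simpa using hor)⟩
  rcases lt_or_gt_of_ne hne with hlt | hlt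
  · exact key ((h ⟨x, hx⟩ : ℤ) + 1) ⟨by omega, by omega⟩ (Or.inl rfl)
  · exact key ((h ⟨x, hx⟩ : ℤ) - 1) ⟨by omega, by omega⟩ (Or.inr (by omega))

theorem IsArc.not_three_neighbours {C : Set X} (hC : IsArc C) {x u v w : X} (hx : x ∈ C)
    (hu : u ∈ C) (hv : v ∈ C) (hw : w ∈ C) (hxu : u ∈ adjacency x) (hxv : v ∈ adjacency x)
    (hxw : w ∈ adjacency x) (huv : u ≠ v) (huw : u ≠ w) : v = w := by
  obtain ⟨a, b, h, hadj⟩ := hC.exists_equiv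
  have hinj : ∀ {s t : X} (hs : s ∈ C) (ht : t ∈ C), (h ⟨s, hs⟩ : ℤ) = h ⟨t, ht⟩ → s = t :=
    fun hs ht e => congrArg Subtype.val (h.injective (Subtype.ext e))
  have h1 := (hadj ⟨x, hx⟩ ⟨u, hu⟩).1 hxu
  have h2 := (hadj ⟨x, hx⟩ ⟨v, hv⟩).1 hxv
  have h3 := (hadj ⟨x, hx⟩ ⟨w, hw⟩).1 hxw
  have n1 := mt (hinj hu hv) huv
  have n2 := mt (hinj hu hw) huw
  exact hinj hv hw (by omega)

theorem IsArc.not_triangle {C : Set X} (hC : IsArc C) {x u v : X} (hx : x ∈ C)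
    (hu : u ∈ C) (hv : v ∈ C) (hxu : u ∈ adjacency x) (hxv : v ∈ adjacency x)
    (huv : v ∈ adjacency u) : False := by
  obtain ⟨a, b, h, hadj⟩ := hC.exists_equiv
  have h1 := (hadj ⟨x, hx⟩ ⟨u, hu⟩).1 hxu
  have h2 := (hadj ⟨x, hx⟩ ⟨v, hv⟩).1 hxv
  have h3 := (hadj ⟨u, hu⟩ ⟨v, hv⟩).1 huv
  omega

theorem IsJordanCurve.finite {J : Set X} (hJ : IsJordanCurve J) : J.Finite := by
  obtain ⟨x, hx⟩ := hJ.1.nonempty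
  exact ((hJ.2.2 x hx).finite.union (finite_singleton x)).subset (by simp)

theorem IsJordanCurve.not_triangle {J : Set X} (hJ : IsJordanCurve J) (hcard : 4 < J.encard)
    {x u v : X} (hx : x ∈ J) (hu : u ∈ J) (hv : v ∈ J) (hxu : u ∈ adjacency x)
    (hxv : v ∈ adjacency x) (huv : v ∈ adjacency u) : False := by
  obtain ⟨z, hz, h1, h2, h3, -⟩ := exists_mem_notMem_of_four_lt hcard x u v v
  exact (hJ.2.2 z hz).not_triangle ⟨hx, h1.symm⟩ ⟨hu, h2.symm⟩ ⟨hv, h3.symm⟩ hxu hxv huv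

theorem IsJordanCurve.exists_neighbour_ne {J : Set X} (hJ : IsJordanCurve J)
    (hcard : 4 < J.encard) {x u : X} (hx : x ∈ J) (hu : u ∈ J) (hxu : x ≠ u) :
    ∃ v ∈ J, v ∈ adjacency x ∧ v ≠ u := by
  obtain ⟨z, hz, h1, h2, -⟩ := exists_mem_notMem_of_four_lt hcard x u u u
  obtain ⟨v, hv, hxv⟩ := (hJ.2.2 u hu).exists_mem_adjacency ⟨hx, hxu⟩ ⟨hz, h2⟩ h1.symm
  exact ⟨v, hv.1, hxv, hv.2⟩

/-- In the arc left after deleting some other point, `x` has a neighbour; deleting that neighbour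
yields a second one. A third would lie with `x` and the first two in a common arc, where an integer
has at most two neighbours. -/
theorem IsJordanCurve.encard_adjacency_inter {J : Set X} (hJ : IsJordanCurve J)
    (hcard : 4 < J.encard) {x : X} (hx : x ∈ J) : (adjacency x ∩ J).encard = 2 := by
  obtain ⟨z, hz, h1, -⟩ := exists_mem_notMem_of_four_lt hcard x x x x
  obtain ⟨u, hu, hxu, -⟩ := hJ.exists_neighbour_ne hcard hx hz h1.symm
  obtain ⟨v, hv, hxv, hvu⟩ := hJ.exists_neighbour_ne hcard hx hu hxu.1.symm
  rw [← encard_pair hvu.symm]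
  congr 1
  ext w
  constructor
  · rintro ⟨hxw, hw⟩
    by_contra hcon
    simp only [mem_insert_iff, mem_singleton_iff, not_or] at hcon
    obtain ⟨y, hy, h1, h2, h3, h4⟩ := exists_mem_notMem_of_four_lt hcard x u v w
    exact hcon.2 ((hJ.2.2 y hy).not_three_neighbours ⟨hx, h1.symm⟩ ⟨hu, h2.symm⟩ ⟨hv, h3.symm⟩
      ⟨hw, h4.symm⟩ hxu hxv hxw hvu.symm (Ne.symm hcon.1)).symm
  · rintro (rfl | rfl)
    exacts [⟨hxu, hu⟩, ⟨hxv, hv⟩]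

end Arc

end DigitalTopology

/-! ### Lattice coordinates: pure points and square centres. -/

namespace DigitalTopology

/-- The mixed point at the centre of the image under `slant` of the unit square with lower left
corner `s`. -/
def squareCentre (s : ℤ × ℤ) : DigitalPlane :=
  (DigitalLine.ofInt (s.1 + s.2 + 1), DigitalLine.ofInt (s.2 - s.1))

/-- `p` is one of the four corners of the unit square with lower left corner `s`. -/
def IsCorner (s p : ℤ × ℤ) : Prop :=
  p = s ∨ p = (s.1 + 1, s.2) ∨ p = (s.1, s.2 + 1) ∨ p = (s.1 + 1, s.2 + 1)

/-- One of the two pairs of opposite corners of the unit square at `s` lies in `A`. -/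
def HasOppositeCorners (A : Set (ℤ × ℤ)) (s : ℤ × ℤ) : Prop :=
  (s ∈ A ∧ (s.1 + 1, s.2 + 1) ∈ A) ∨ ((s.1 + 1, s.2) ∈ A ∧ (s.1, s.2 + 1) ∈ A)

theorem FourAdj.symm {p q : ℤ × ℤ} (h : FourAdj p q) : FourAdj q p := by
  obtain ⟨a, b⟩ := p
  obtain ⟨c, d⟩ := q
  simp only [FourAdj, Prod.mk.injEq] at *
  omega

theorem slant_injective : Function.Injective slant := by
  rintro ⟨a, b⟩ ⟨c, d⟩ h
  simp only [slant, Prod.mk.injEq, DigitalLine.ofInt.apply_eq_iff_eq] at h ⊢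
  omega

theorem squareCentre_injective : Function.Injective squareCentre := by
  rintro ⟨a, b⟩ ⟨c, d⟩ h
  simp only [squareCentre, Prod.mk.injEq, DigitalLine.ofInt.apply_eq_iff_eq] at h ⊢
  omega

theorem slant_ne_squareCentre (p s : ℤ × ℤ) : slant p ≠ squareCentre s := by
  intro h
  simp only [slant, squareCentre, Prod.mk.injEq, DigitalLine.ofInt.apply_eq_iff_eq] at h
  omega

theorem isPure_slant (p : ℤ × ℤ) : IsPure (slant p) := by
  simp only [IsPure, slant, DigitalLine.toInt, Equiv.symm_apply_apply, Int.even_iff, Int.odd_iff]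
  omega

theorem isMixed_squareCentre (s : ℤ × ℤ) : IsMixed (squareCentre s) := by
  simp only [IsMixed, IsPure, squareCentre, DigitalLine.toInt, Equiv.symm_apply_apply,
    Int.even_iff, Int.odd_iff]
  omega

theorem eq_slant_or_eq_squareCentre (x : DigitalPlane) :
    (∃ p, x = slant p) ∨ ∃ s, x = squareCentre s := by
  obtain ⟨x, y⟩ := x
  obtain ⟨a, rfl⟩ := DigitalLine.ofInt.surjective x
  obtain ⟨b, rfl⟩ := DigitalLine.ofInt.surjective y
  simp only [slant, squareCentre, Prod.mk.injEq, DigitalLine.ofInt.apply_eq_iff_eq]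
  rcases Int.emod_two_eq_zero_or_one (a + b) with h | h
  · exact Or.inl ⟨((a - b) / 2, (a + b) / 2), by dsimp only; omega, by dsimp only; omega⟩
  · exact Or.inr ⟨((a - 1 - b) / 2, (a - 1 + b) / 2), by dsimp only; omega, by dsimp only; omega⟩

theorem specializes_ofInt_iff {a b c d : ℤ} :
    ((DigitalLine.ofInt a, DigitalLine.ofInt b) : DigitalPlane) ⤳
      (DigitalLine.ofInt c, DigitalLine.ofInt d) ↔
      (a = c ∨ (c % 2 = 0 ∧ (a = c - 1 ∨ a = c + 1))) ∧
      (b = d ∨ (d % 2 = 0 ∧ (b = d - 1 ∨ b = d + 1))) := by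
  rw [specializes_prod, DigitalLine.specializes_iff, DigitalLine.specializes_iff,
    DigitalLine.mem_basicNhd, DigitalLine.mem_basicNhd, Int.even_iff, Int.even_iff]

theorem slant_mem_adjacency_slant {p q : ℤ × ℤ} :
    slant q ∈ adjacency (slant p) ↔ FourAdj p q := by
  obtain ⟨a, b⟩ := p
  obtain ⟨c, d⟩ := q
  rw [mem_adjacency_iff, slant_injective.ne_iff]
  simp only [slant, specializes_ofInt_iff, FourAdj, Prod.mk.injEq, ne_eq]
  omega

theorem slant_mem_adjacency_squareCentre {p s : ℤ × ℤ} :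
    slant p ∈ adjacency (squareCentre s) ↔ IsCorner s p := by
  obtain ⟨a, b⟩ := p
  obtain ⟨c, d⟩ := s
  rw [mem_adjacency_iff, and_iff_right (slant_ne_squareCentre _ _)]
  simp only [slant, squareCentre, specializes_ofInt_iff, IsCorner, Prod.mk.injEq]
  omega

theorem squareCentre_mem_adjacency_slant {p s : ℤ × ℤ} :
    squareCentre s ∈ adjacency (slant p) ↔ IsCorner s p := by
  rw [mem_adjacency_comm, slant_mem_adjacency_squareCentre]

theorem squareCentre_notMem_adjacency_squareCentre {s t : ℤ × ℤ} :
    squareCentre t ∉ adjacency (squareCentre s) := by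
  obtain ⟨a, b⟩ := s
  obtain ⟨c, d⟩ := t
  rw [mem_adjacency_iff, squareCentre_injective.ne_iff]
  simp only [squareCentre, specializes_ofInt_iff, Prod.mk.injEq, ne_eq]
  omega

theorem slant_mem_slantStar {A : Set (ℤ × ℤ)} {p : ℤ × ℤ} : slant p ∈ slantStar A ↔ p ∈ A := by
  refine ⟨fun h => h.elim slant_injective.mem_set_image.1 fun h => absurd (isPure_slant p) h.1,
    fun h => Or.inl ⟨p, h, rfl⟩⟩

/-- The parity of `s.1 + s.2` decides which coordinate of the centre is even, hence which diagonal
lies in its smallest open set; the other diagonal lies in its closure. -/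
theorem slant_specializes_squareCentre {s p : ℤ × ℤ} :
    slant p ⤳ squareCentre s ↔
      if (s.1 + s.2) % 2 = 0 then p = (s.1 + 1, s.2) ∨ p = (s.1, s.2 + 1)
      else p = s ∨ p = (s.1 + 1, s.2 + 1) := by
  obtain ⟨a, b⟩ := p
  obtain ⟨c, d⟩ := s
  simp only [slant, squareCentre, specializes_ofInt_iff, Prod.mk.injEq]
  split_ifs <;> omega

theorem squareCentre_specializes_slant {s p : ℤ × ℤ} :
    squareCentre s ⤳ slant p ↔
      if (s.1 + s.2) % 2 = 0 then p = s ∨ p = (s.1 + 1, s.2 + 1)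
      else p = (s.1 + 1, s.2) ∨ p = (s.1, s.2 + 1) := by
  obtain ⟨a, b⟩ := p
  obtain ⟨c, d⟩ := s
  simp only [slant, squareCentre, specializes_ofInt_iff, Prod.mk.injEq]
  split_ifs <;> omega

theorem subset_slant_image_union_squareCentre {A : Set (ℤ × ℤ)} {s : ℤ × ℤ} {T : Set DigitalPlane}
    (hT : ∀ t, squareCentre t ∈ T → t = s) :
    T ⊆ slant '' A ∪ {squareCentre s} ↔ ∀ p, slant p ∈ T → p ∈ A := by
  constructor
  · intro h p hp
    rcases h hp with h | h
    · exact slant_injective.mem_set_image.1 h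
    · exact absurd h (slant_ne_squareCentre _ _)
  · intro h x hx
    rcases eq_slant_or_eq_squareCentre x with ⟨p, rfl⟩ | ⟨t, rfl⟩
    · exact Or.inl ⟨p, h p hx, rfl⟩
    · exact Or.inr (by rw [hT t hx]; rfl)

/-- The two alternatives defining `slantStar` test one diagonal each. Exchanging them with the
parity of the square does not affect their disjunction, so parity disappears. -/
theorem squareCentre_mem_slantStar {A : Set (ℤ × ℤ)} {s : ℤ × ℤ} :
    squareCentre s ∈ slantStar A ↔ HasOppositeCorners A s := by
  have h0 : squareCentre s ∉ slant '' A := by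
    rintro ⟨p, -, hp⟩
    exact slant_ne_squareCentre _ _ hp
  have hcl : ∀ t, squareCentre t ⤳ squareCentre s ∨ squareCentre s ⤳ squareCentre t → t = s := by
    intro t ht
    by_contra hne
    exact squareCentre_notMem_adjacency_squareCentre (s := s) (t := t)
      (mem_adjacency_iff.2 ⟨squareCentre_injective.ne hne, ht.symm⟩)
  rw [slantStar, mem_union, or_iff_right h0, mem_ofPred_eq, and_iff_right (isMixed_squareCentre s),
    subset_slant_image_union_squareCentre (fun t ht => hcl t (Or.inl (mem_nhdsKer_singleton.1 ht))),
    subset_slant_image_union_squareCentre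
      (fun t ht => hcl t (Or.inr (specializes_iff_mem_closure.2 ht)))]
  simp only [mem_nhdsKer_singleton, ← specializes_iff_mem_closure, slant_specializes_squareCentre,
    squareCentre_specializes_slant, HasOppositeCorners]
  split_ifs <;> simp only [forall_eq_or_imp, forall_eq]
  exact or_comm

theorem squareCentre_mem_mixedFill {A : Set (ℤ × ℤ)} {J : Set DigitalPlane} {s : ℤ × ℤ} :
    squareCentre s ∈ mixedFill A J ↔ ∀ p, IsCorner s p → p ∈ A ∪ slant ⁻¹' J := by
  rw [mixedFill, mem_ofPred_eq, and_iff_right (isMixed_squareCentre s)]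
  constructor
  · intro h p hp
    exact (h (slant_mem_adjacency_squareCentre.2 hp)).imp slant_injective.mem_set_image.1 id
  · intro h x hx
    rcases eq_slant_or_eq_squareCentre x with ⟨p, rfl⟩ | ⟨t, rfl⟩
    · exact (h p (slant_mem_adjacency_squareCentre.1 hx)).imp (fun h => ⟨p, h, rfl⟩) id
    · exact absurd hx squareCentre_notMem_adjacency_squareCentre

theorem slant_notMem_mixedFill {A : Set (ℤ × ℤ)} {J : Set DigitalPlane} {p : ℤ × ℤ} :
    slant p ∉ mixedFill A J := fun h => h.1 (isPure_slant p)

end DigitalTopology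

/-! ### The parity colouring and its local behaviour. -/

namespace DigitalTopology

/-- The indicator function of a set of lattice points, with values modulo 2. -/
noncomputable def ind (C : Set (ℤ × ℤ)) (p : ℤ × ℤ) : ZMod 2 := C.indicator 1 p

theorem ind_of_mem {C : Set (ℤ × ℤ)} {p : ℤ × ℤ} (h : p ∈ C) : ind C p = 1 := by simp [ind, h]

theorem ind_eq_zero {C : Set (ℤ × ℤ)} {p : ℤ × ℤ} : ind C p = 0 ↔ p ∉ C := by simp [ind]

/-- The number of points of `C` among the eight lattice points surrounding `p`. -/
noncomputable def ringCount (C : Set (ℤ × ℤ)) (p : ℤ × ℤ) : ℕ :=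
  (ind C (p.1 + 1, p.2)).val + (ind C (p.1 + 1, p.2 + 1)).val + (ind C (p.1, p.2 + 1)).val +
  (ind C (p.1 - 1, p.2 + 1)).val + (ind C (p.1 - 1, p.2)).val + (ind C (p.1 - 1, p.2 - 1)).val +
  (ind C (p.1, p.2 - 1)).val + (ind C (p.1 + 1, p.2 - 1)).val

/-- A finite set of lattice points each of which has exactly two 8-neighbours in the set, and which
contains no three corners of a unit square. -/
structure IsEightCurve (C : Set (ℤ × ℤ)) : Prop where
  finite : C.Finite
  ringCount_eq_two : ∀ p ∈ C, ringCount C p = 2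
  corners : ∀ s p q r, IsCorner s p → IsCorner s q → IsCorner s r → p ∈ C → q ∈ C → r ∈ C →
    p = q ∨ p = r ∨ q = r

/-- The number modulo 2 of points of `C` that are 8-adjacent to `p ∈ C` and lie in the row
above `p`. -/
noncomputable def upDegree (C : Set (ℤ × ℤ)) (x y : ℤ) : ZMod 2 :=
  ind C (x, y) * (ind C (x - 1, y + 1) + ind C (x, y + 1) + ind C (x + 1, y + 1))

/-- The number modulo 2 of crossings of `C` with the horizontal ray issuing from `p` to the right,
truncated at abscissa `R`. -/
noncomputable def colour (C : Set (ℤ × ℤ)) (R : ℤ) (p : ℤ × ℤ) : ZMod 2 :=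
  ∑ t ∈ Finset.Ioc p.1 R, upDegree C t p.2

section Colour

variable {C : Set (ℤ × ℤ)} {R : ℤ}

theorem colour_left (hR : ∀ p ∈ C, p.1 ≤ R) (x y : ℤ) :
    colour C R (x - 1, y) = colour C R (x, y) + upDegree C x y := by
  unfold colour
  rcases le_or_gt x R with h | h
  · have : Finset.Ioc (x - 1) R = insert x (Finset.Ioc x R) := by
      ext t
      simp only [Finset.mem_Ioc, Finset.mem_insert]
      omega
    rw [this, Finset.sum_insert (by simp), add_comm]
  · have h0 : ind C (x, y) = 0 := ind_eq_zero.2 fun hc => absurd (hR _ hc) (not_le.2 h)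
    rw [Finset.Ioc_eq_empty (by simp; omega), Finset.Ioc_eq_empty (by simp; omega)]
    simp [upDegree, h0]

theorem sum_ring_eq_zero (hC : IsEightCurve C) {p : ℤ × ℤ} :
    ind C p * (ind C (p.1 + 1, p.2) + ind C (p.1 + 1, p.2 + 1) + ind C (p.1, p.2 + 1) +
      ind C (p.1 - 1, p.2 + 1) + ind C (p.1 - 1, p.2) + ind C (p.1 - 1, p.2 - 1) +
      ind C (p.1, p.2 - 1) + ind C (p.1 + 1, p.2 - 1)) = 0 := by
  by_cases hp : p ∈ C
  · have h := congrArg (Nat.cast : ℕ → ZMod 2) (hC.ringCount_eq_two p hp)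
    simp only [ringCount, Nat.cast_add, ZMod.natCast_zmod_val] at h
    rw [h]
    exact mul_eq_zero_of_right _ rfl
  · rw [ind_eq_zero.2 hp, zero_mul]

/-- Add the degrees of the curve points of row `y + 1` to the right of `x`; each is even. Horizontal
edges among them count twice, so modulo 2 only the edges between columns `x` and `x + 1` remain as a
correction: one horizontal and two diagonal. -/
theorem colour_up (hC : IsEightCurve C) (hR : ∀ p ∈ C, p.1 ≤ R) (x y : ℤ) :
    colour C R (x, y + 1) = colour C R (x, y) + (ind C (x, y + 1) * ind C (x + 1, y + 1) +
      ind C (x + 1, y) * ind C (x, y + 1) + ind C (x, y) * ind C (x + 1, y + 1)) := by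
  have two : (2 : ZMod 2) = 0 := rfl
  have base : ∀ x, R ≤ x → colour C R (x, y + 1) = colour C R (x, y) +
      (ind C (x, y + 1) * ind C (x + 1, y + 1) +
      ind C (x + 1, y) * ind C (x, y + 1) + ind C (x, y) * ind C (x + 1, y + 1)) := by
    intro x hx
    have h0 : ∀ z, ind C (x + 1, z) = 0 := fun z =>
      ind_eq_zero.2 fun hc => absurd (hR _ hc) (by simp; omega)
    unfold colour
    rw [Finset.Ioc_eq_empty (by simp; omega), h0, h0]
    simp
  rcases le_or_gt R x with h | h
  · exact base x h
  · induction x, h.le using Int.leInductionDown with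
    | base => exact base R le_rfl
    | pred x hx ih =>
      have ih' : colour C R (x, y + 1) = colour C R (x, y) + (ind C (x, y + 1) *
          ind C (x + 1, y + 1) + ind C (x + 1, y) * ind C (x, y + 1) +
          ind C (x, y) * ind C (x + 1, y + 1)) := by
        rcases hx.lt_or_eq with h | h
        · exact ih h
        · exact base x h.ge
      have hs := sum_ring_eq_zero hC (p := (x, y + 1))
      rw [colour_left hR, colour_left hR, ih']
      simp only [upDegree, add_sub_cancel_right, sub_add_cancel] at hs ⊢
      -- `hs` is the even degree at `(x, y + 1)`; the multiples of `two` remove the products that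
      -- occur twice.
      linear_combination hs - (ind C (x, y) * ind C (x - 1, y + 1) +
        ind C (x - 1, y) * ind C (x, y + 1) + ind C (x, y + 1) * ind C (x - 1, y + 1) +
        ind C (x, y + 1) * ind C (x, y)) * two

theorem colour_east (hR : ∀ p ∈ C, p.1 ≤ R) {x y : ℤ} (h : (x + 1, y) ∉ C) :
    colour C R (x + 1, y) = colour C R (x, y) := by
  have := colour_left hR (x + 1) y
  rw [upDegree, ind_eq_zero.2 h, zero_mul, add_zero, add_sub_cancel_right] at this
  exact this.symm

theorem colour_north (hC : IsEightCurve C) (hR : ∀ p ∈ C, p.1 ≤ R) {x y : ℤ} (hc : (x, y) ∈ C)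
    (h : (x, y + 1) ∉ C) :
    colour C R (x, y + 1) = colour C R (x, y) + ind C (x + 1, y + 1) := by
  rw [colour_up hC hR, ind_eq_zero.2 h, ind_of_mem hc]
  ring

theorem colour_west (hR : ∀ p ∈ C, p.1 ≤ R) {x y : ℤ} (hc : (x, y) ∈ C) :
    colour C R (x - 1, y) = colour C R (x, y) +
      (ind C (x - 1, y + 1) + ind C (x, y + 1) + ind C (x + 1, y + 1)) := by
  rw [colour_left hR, upDegree, ind_of_mem hc, one_mul]

theorem colour_south (hC : IsEightCurve C) (hR : ∀ p ∈ C, p.1 ≤ R) {x y : ℤ} (hc : (x, y) ∈ C)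
    (h : (x, y - 1) ∉ C) :
    colour C R (x, y - 1) = colour C R (x, y) + (ind C (x + 1, y) + ind C (x + 1, y - 1)) := by
  have h1 := colour_up hC hR x (y - 1)
  rw [sub_add_cancel, ind_eq_zero.2 h, ind_of_mem hc] at h1
  have two : (2 : ZMod 2) = 0 := rfl
  linear_combination -h1 - (ind C (x + 1, y) + ind C (x + 1, y - 1)) * two

theorem colour_eq_of_fourAdj (hC : IsEightCurve C) (hR : ∀ p ∈ C, p.1 ≤ R) {p q : ℤ × ℤ}
    (hp : p ∉ C) (hq : q ∉ C) (h : FourAdj p q) : colour C R p = colour C R q := by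
  have up : ∀ x y, (x, y) ∉ C → (x, y + 1) ∉ C → colour C R (x, y) = colour C R (x, y + 1) := by
    intro x y h1 h2
    rw [colour_up hC hR, ind_eq_zero.2 h1, ind_eq_zero.2 h2]
    ring
  obtain ⟨x, y⟩ := p
  rcases h with rfl | rfl | rfl | rfl
  · exact (colour_east hR hq).symm
  · have := colour_east hR (x := x - 1) (y := y) (by simpa using hp)
    simpa using this
  · exact up x y hp hq
  · have := up x (y - 1) hq (by simpa using hp)
    simpa using this.symm

/-- `p` and `q` are joined by a 4-path in the complement of `C`. -/
def FourJoined (C : Set (ℤ × ℤ)) : ℤ × ℤ → ℤ × ℤ → Prop :=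
  Relation.ReflTransGen fun p q => p ∉ C ∧ q ∉ C ∧ FourAdj p q

theorem FourJoined.symm {p q : ℤ × ℤ} (h : FourJoined C p q) : FourJoined C q p := by
  induction h with
  | refl => exact .refl
  | tail _ h ih => exact .head ⟨h.2.1, h.1, h.2.2.symm⟩ ih

theorem FourJoined.trans {p q r : ℤ × ℤ} (h : FourJoined C p q) (h' : FourJoined C q r) :
    FourJoined C p r := Relation.ReflTransGen.trans h h'

theorem fourJoined_of_fourAdj {p q : ℤ × ℤ} (hp : p ∉ C) (hq : q ∉ C) (h : FourAdj p q) :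
    FourJoined C p q := Relation.ReflTransGen.single ⟨hp, hq, h⟩

theorem fourJoined_of_corner {p q r : ℤ × ℤ} (hp : p ∉ C) (hq : q ∉ C) (hr : r ∉ C)
    (h : FourAdj p q) (h' : FourAdj q r) : FourJoined C p r :=
  (fourJoined_of_fourAdj hp hq h).trans (fourJoined_of_fourAdj hq hr h')

/-- The two triples are the ring points on either side of a line through a curve point whose two
ring points are off the curve. An even count in the first triple is 0 or 2, and 2 exhausts the
total. -/
theorem side_free_of_sum_eq_zero (a b c d e f : ZMod 2)
    (h : a.val + b.val + c.val + d.val + e.val + f.val = 2) (h' : a + b + c = 0) :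
    (a = 0 ∧ b = 0 ∧ c = 0) ∨ (d = 0 ∧ e = 0 ∧ f = 0) := by
  have cases : ∀ z : ZMod 2, z = 0 ∨ z = 1 := by decide
  revert h h'
  rcases cases a with rfl | rfl <;> rcases cases b with rfl | rfl <;>
    rcases cases c with rfl | rfl <;> decide +revert

/-- Two 4-neighbours of a point of the curve that have the same colour are joined off the curve. -/
theorem fourJoined_of_colour_eq (hC : IsEightCurve C) (hR : ∀ p ∈ C, p.1 ≤ R) {c p q : ℤ × ℤ}
    (hc : c ∈ C) (hp : p ∉ C) (hq : q ∉ C) (hcp : FourAdj c p) (hcq : FourAdj c q)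
    (h : colour C R p = colour C R q) : FourJoined C p q := by
  obtain ⟨x, y⟩ := c
  have hring := hC.ringCount_eq_two _ hc
  simp only [ringCount] at hring
  have hE := colour_east hR (x := x) (y := y)
  have hN := colour_north hC hR hc
  have hW := colour_west hR hc
  have hS := colour_south hC hR hc
  have two : (2 : ZMod 2) = 0 := rfl
  -- For two consecutive directions the colours differ by the indicator of the ring point between
  -- them, so equal colours leave that point free as a passage.
  have hEN : (x + 1, y) ∉ C → (x, y + 1) ∉ C → colour C R (x + 1, y) = colour C R (x, y + 1) →
      FourJoined C (x + 1, y) (x, y + 1) := by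
    intro h1 h2 h3
    have h0 : (x + 1, y + 1) ∉ C := ind_eq_zero.1 (by
      linear_combination hE h1 - hN h2 - h3)
    exact fourJoined_of_corner h1 h0 h2 (by simp [FourAdj]) (by simp [FourAdj])
  have hNW : (x, y + 1) ∉ C → (x - 1, y) ∉ C → colour C R (x, y + 1) = colour C R (x - 1, y) →
      FourJoined C (x, y + 1) (x - 1, y) := by
    intro h1 h2 h3
    have h0 : (x - 1, y + 1) ∉ C := ind_eq_zero.1 (by
      have := ind_eq_zero.2 h1
      linear_combination hN h1 - hW - h3 - this)
    exact fourJoined_of_corner h1 h0 h2 (by simp [FourAdj]) (by simp [FourAdj])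
  have hES : (x + 1, y) ∉ C → (x, y - 1) ∉ C → colour C R (x + 1, y) = colour C R (x, y - 1) →
      FourJoined C (x + 1, y) (x, y - 1) := by
    intro h1 h2 h3
    have h0 : (x + 1, y - 1) ∉ C := ind_eq_zero.1 (by
      have := ind_eq_zero.2 h1
      linear_combination hE h1 - hS h2 - h3 - this)
    exact fourJoined_of_corner h1 h0 h2 (by simp [FourAdj]) (by simp [FourAdj])
  have hWS : (x - 1, y) ∉ C → (x, y - 1) ∉ C → colour C R (x - 1, y) = colour C R (x, y - 1) →
      FourJoined C (x - 1, y) (x, y - 1) := by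
    intro h1 h2 h3
    have h0 : (x - 1, y - 1) ∉ C := ind_eq_zero.1 (by
      have e1 := ind_eq_zero.2 h1
      have e2 := ind_eq_zero.2 h2
      have hs := sum_ring_eq_zero hC (p := (x, y))
      rw [ind_of_mem hc, one_mul] at hs
      dsimp only at hs
      linear_combination hs - e1 - e2 - hW + hS h2 + h3 -
        (ind C (x - 1, y + 1) + ind C (x, y + 1) + ind C (x + 1, y + 1)) * two)
    exact fourJoined_of_corner h1 h0 h2 (by simp [FourAdj]) (by simp [FourAdj])
  -- For opposite directions, equal colours mean an even number of curve points in the half ring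
  -- above, so one of the two half rings is entirely free.
  have hEW : (x + 1, y) ∉ C → (x - 1, y) ∉ C → colour C R (x + 1, y) = colour C R (x - 1, y) →
      FourJoined C (x + 1, y) (x - 1, y) := by
    intro h1 h2 h3
    rw [ind_eq_zero.2 h1, ind_eq_zero.2 h2, ZMod.val_zero] at hring
    have hsum : ind C (x + 1, y + 1) + ind C (x, y + 1) + ind C (x - 1, y + 1) = 0 := by
      linear_combination hE h1 - hW - h3
    rcases side_free_of_sum_eq_zero _ _ _ (ind C (x + 1, y - 1)) (ind C (x, y - 1))
      (ind C (x - 1, y - 1)) (by omega) hsum with ⟨a, b, c⟩ | ⟨a, b, c⟩ <;>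
      rw [ind_eq_zero] at a b c
    · exact (fourJoined_of_corner h1 a b (by simp [FourAdj]) (by simp [FourAdj])).trans
        (fourJoined_of_corner b c h2 (by simp [FourAdj]) (by simp [FourAdj]))
    · exact (fourJoined_of_corner h1 a b (by simp [FourAdj]) (by simp [FourAdj])).trans
        (fourJoined_of_corner b c h2 (by simp [FourAdj]) (by simp [FourAdj]))
  have hNS : (x, y + 1) ∉ C → (x, y - 1) ∉ C → colour C R (x, y + 1) = colour C R (x, y - 1) →
      FourJoined C (x, y + 1) (x, y - 1) := by
    intro h1 h2 h3
    rw [ind_eq_zero.2 h1, ind_eq_zero.2 h2, ZMod.val_zero] at hring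
    have hsum : ind C (x + 1, y + 1) + ind C (x + 1, y) + ind C (x + 1, y - 1) = 0 := by
      linear_combination -hN h1 + hS h2 + h3 + (ind C (x + 1, y) + ind C (x + 1, y - 1)) * two
    rcases side_free_of_sum_eq_zero _ _ _ (ind C (x - 1, y + 1)) (ind C (x - 1, y))
      (ind C (x - 1, y - 1)) (by omega) hsum with ⟨a, b, c⟩ | ⟨a, b, c⟩ <;>
      rw [ind_eq_zero] at a b c
    · exact (fourJoined_of_corner h1 a b (by simp [FourAdj]) (by simp [FourAdj])).trans
        (fourJoined_of_corner b c h2 (by simp [FourAdj]) (by simp [FourAdj]))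
    · exact (fourJoined_of_corner h1 a b (by simp [FourAdj]) (by simp [FourAdj])).trans
        (fourJoined_of_corner b c h2 (by simp [FourAdj]) (by simp [FourAdj]))
  rcases hcp with rfl | rfl | rfl | rfl <;> rcases hcq with rfl | rfl | rfl | rfl
  · exact .refl
  · exact hEW hp hq h
  · exact hEN hp hq h
  · exact hES hp hq h
  · exact (hEW hq hp h.symm).symm
  · exact .refl
  · exact (hNW hq hp h.symm).symm
  · exact hWS hp hq h
  · exact (hEN hq hp h.symm).symm
  · exact hNW hp hq h
  · exact .refl
  · exact hNS hp hq h
  · exact (hES hq hp h.symm).symm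
  · exact (hWS hq hp h.symm).symm
  · exact (hNS hq hp h.symm).symm
  · exact .refl

/-- The variables indicate the ring points of a curve point of colour `k`, and the twelve
disjunctions say that none of the four squares at that point has two further corners on the curve.
The conclusion finds a free 4-neighbour of colour `i`; the offsets are those of `colour_east`,
`colour_north`, `colour_west` and `colour_south`. -/
theorem ring_colours (e ne n nw w sw s se k i : ZMod 2)
    (h : e.val + ne.val + n.val + nw.val + w.val + sw.val + s.val + se.val = 2)
    (h1 : e = 0 ∨ n = 0) (h2 : e = 0 ∨ ne = 0) (h3 : ne = 0 ∨ n = 0)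
    (h4 : n = 0 ∨ nw = 0) (h5 : nw = 0 ∨ w = 0) (h6 : n = 0 ∨ w = 0)
    (h7 : w = 0 ∨ sw = 0) (h8 : sw = 0 ∨ s = 0) (h9 : w = 0 ∨ s = 0)
    (h10 : s = 0 ∨ se = 0) (h11 : se = 0 ∨ e = 0) (h12 : s = 0 ∨ e = 0) :
    (e = 0 ∧ k = i) ∨ (n = 0 ∧ k + ne = i) ∨ (w = 0 ∧ k + (nw + n + ne) = i) ∨
      (s = 0 ∧ k + (e + se) = i) := by
  have cases : ∀ z : ZMod 2, z = 0 ∨ z = 1 := by decide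
  rcases cases e with rfl | rfl <;> rcases cases n with rfl | rfl <;>
    rcases cases w with rfl | rfl <;> rcases cases s with rfl | rfl <;>
    simp only [one_ne_zero, or_false, false_or, true_or, or_true] at * <;> subst_vars <;>
    decide +revert

end Colour

end DigitalTopology

/-! ### The two sides of an 8-curve. -/

namespace DigitalTopology

section Sides

variable {C : Set (ℤ × ℤ)} {R : ℤ}

/-- The points off the curve with colour `i`. -/
def side (C : Set (ℤ × ℤ)) (R : ℤ) (i : ZMod 2) : Set (ℤ × ℤ) := {p | p ∉ C ∧ colour C R p = i}

theorem eq_or_eq_add_one (i j : ZMod 2) : i = j ∨ i = j + 1 := by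
  decide +revert

theorem side_zero_union_side_one : side C R 0 ∪ side C R 1 = Cᶜ := by
  ext p
  constructor
  · rintro (h | h) <;> exact h.1
  · intro h
    exact (eq_or_eq_add_one (colour C R p) 0).imp (fun e => ⟨h, e⟩) (fun e => ⟨h, e⟩)

theorem eq_of_mem_side {i j : ZMod 2} {p : ℤ × ℤ} (hi : p ∈ side C R i) (hj : p ∈ side C R j) :
    i = j := hi.2.symm.trans hj.2

theorem FourJoined.mem_side (hC : IsEightCurve C) (hR : ∀ p ∈ C, p.1 ≤ R) {i : ZMod 2}
    {p q : ℤ × ℤ} (h : FourJoined C p q) (hp : p ∈ side C R i) : q ∈ side C R i := by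
  induction h with
  | refl => exact hp
  | tail _ h ih => exact ⟨h.2.1, (colour_eq_of_fourAdj hC hR h.1 h.2.1 h.2.2).symm.trans ih.2⟩

theorem exists_fourAdj_mem_side (hC : IsEightCurve C) (hR : ∀ p ∈ C, p.1 ≤ R) {c : ℤ × ℤ}
    (hc : c ∈ C) (i : ZMod 2) : ∃ p ∈ side C R i, FourAdj c p := by
  obtain ⟨x, y⟩ := c
  have hring := hC.ringCount_eq_two _ hc
  simp only [ringCount] at hring
  have corner : ∀ s p q, IsCorner s (x, y) → IsCorner s p → IsCorner s q → p ≠ (x, y) →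
      q ≠ (x, y) → p ≠ q → ind C p = 0 ∨ ind C q = 0 := by
    intro s p q h1 h2 h3 n1 n2 n3
    rw [ind_eq_zero, ind_eq_zero]
    by_contra! hcon
    rcases hC.corners s _ _ _ h1 h2 h3 hc hcon.1 hcon.2 with h | h | h
    exacts [n1 h.symm, n2 h.symm, n3 h]
  rcases ring_colours _ _ _ _ _ _ _ _ (colour C R (x, y)) i hring
    (by apply corner (x, y) <;> simp [IsCorner]) (by apply corner (x, y) <;> simp [IsCorner])
    (by apply corner (x, y) <;> simp [IsCorner]) (by apply corner (x - 1, y) <;> simp [IsCorner]; omega)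
    (by apply corner (x - 1, y) <;> simp [IsCorner]) (by apply corner (x - 1, y) <;> simp [IsCorner])
    (by apply corner (x - 1, y - 1) <;> simp [IsCorner]; omega)
    (by apply corner (x - 1, y - 1) <;> simp [IsCorner])
    (by apply corner (x - 1, y - 1) <;> simp [IsCorner])
    (by apply corner (x, y - 1) <;> simp [IsCorner]) (by apply corner (x, y - 1) <;> simp [IsCorner])
    (by apply corner (x, y - 1) <;> simp [IsCorner]) with ⟨h, h'⟩ | ⟨h, h'⟩ | ⟨h, h'⟩ | ⟨h, h'⟩ <;>
    rw [ind_eq_zero] at h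
  · exact ⟨_, ⟨h, (colour_east hR h).trans h'⟩, by simp [FourAdj]⟩
  · exact ⟨_, ⟨h, (colour_north hC hR hc h).trans h'⟩, by simp [FourAdj]⟩
  · exact ⟨_, ⟨h, (colour_west hR hc).trans h'⟩, by simp [FourAdj]⟩
  · exact ⟨_, ⟨h, (colour_south hC hR hc h).trans h'⟩, by simp [FourAdj]⟩

theorem IsEightCurve.notMem_of_diag (hC : IsEightCurve C) {s : ℤ × ℤ} (h : s ∈ C)
    (h' : (s.1 + 1, s.2 + 1) ∈ C) : (s.1 + 1, s.2) ∉ C ∧ (s.1, s.2 + 1) ∉ C := by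
  constructor <;> intro hq <;>
    have := hC.corners s _ _ _ (by simp [IsCorner]) (by simp [IsCorner]) (by simp [IsCorner]) h h' hq
  · simp [Prod.ext_iff] at this
  · simp [Prod.ext_iff] at this

theorem IsEightCurve.notMem_of_antidiag (hC : IsEightCurve C) {s : ℤ × ℤ} (h : (s.1 + 1, s.2) ∈ C)
    (h' : (s.1, s.2 + 1) ∈ C) : s ∉ C ∧ (s.1 + 1, s.2 + 1) ∉ C := by
  constructor <;> intro hq <;>
    have := hC.corners s _ _ _ (by simp [IsCorner]) (by simp [IsCorner]) (by simp [IsCorner]) h h' hq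
  · simp [Prod.ext_iff] at this
  · simp [Prod.ext_iff] at this

/-- A diagonal step of the curve passes between the other two corners of its square and so separates
them. -/
theorem colour_of_diag (hC : IsEightCurve C) (hR : ∀ p ∈ C, p.1 ≤ R) {s : ℤ × ℤ} (h : s ∈ C)
    (h' : (s.1 + 1, s.2 + 1) ∈ C) :
    colour C R (s.1, s.2 + 1) = colour C R (s.1 + 1, s.2) + 1 := by
  obtain ⟨h1, h2⟩ := hC.notMem_of_diag h h'
  rw [colour_east hR h1, colour_north hC hR h h2, ind_of_mem h']

theorem colour_of_antidiag (hC : IsEightCurve C) (hR : ∀ p ∈ C, p.1 ≤ R) {s : ℤ × ℤ}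
    (h : (s.1 + 1, s.2) ∈ C) (h' : (s.1, s.2 + 1) ∈ C) :
    colour C R s = colour C R (s.1 + 1, s.2 + 1) + 1 := by
  obtain ⟨h1, h2⟩ := hC.notMem_of_antidiag h h'
  have hw := colour_west hR h
  rw [add_sub_cancel_right, ind_of_mem h', ind_eq_zero.2 h2] at hw
  rw [colour_north hC hR h h2]
  change colour C R (s.1, s.2) = _
  rw [hw]
  ring

theorem exists_corner_mem_side (hC : IsEightCurve C) (hR : ∀ p ∈ C, p.1 ≤ R) {s : ℤ × ℤ}
    (h : HasOppositeCorners C s) (i : ZMod 2) : ∃ p ∈ side C R i, IsCorner s p := by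
  rcases h with ⟨h, h'⟩ | ⟨h, h'⟩
  · obtain ⟨h1, h2⟩ := hC.notMem_of_diag h h'
    rcases eq_or_eq_add_one i (colour C R (s.1 + 1, s.2)) with e | e
    · exact ⟨_, ⟨h1, e.symm⟩, by simp [IsCorner]⟩
    · exact ⟨_, ⟨h2, (colour_of_diag hC hR h h').trans e.symm⟩, by simp [IsCorner]⟩
  · obtain ⟨h1, h2⟩ := hC.notMem_of_antidiag h h'
    rcases eq_or_eq_add_one i (colour C R (s.1 + 1, s.2 + 1)) with e | e
    · exact ⟨_, ⟨h2, e.symm⟩, by simp [IsCorner]⟩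
    · exact ⟨_, ⟨h1, (colour_of_antidiag hC hR h h').trans e.symm⟩, by simp [IsCorner]⟩

theorem not_hasOppositeCorners_side (hC : IsEightCurve C) (hR : ∀ p ∈ C, p.1 ≤ R) {s : ℤ × ℤ}
    (h : HasOppositeCorners C s) (i : ZMod 2) : ¬ HasOppositeCorners (side C R i) s := by
  rintro (⟨h1, h2⟩ | ⟨h1, h2⟩) <;> rcases h with ⟨h, h'⟩ | ⟨h, h'⟩
  · exact h1.1 h
  · have := colour_of_antidiag hC hR h h'
    rw [h1.2, h2.2] at this
    simp at this
  · have := colour_of_diag hC hR h h'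
    rw [h1.2, h2.2] at this
    simp at this
  · exact h1.1 h

/-- The corners off the curve of a unit square with no opposite corners on the curve lie on the same
side. -/
theorem mem_side_of_isCorner (hC : IsEightCurve C) (hR : ∀ p ∈ C, p.1 ≤ R) {s p q : ℤ × ℤ}
    (h : ¬ HasOppositeCorners C s) {i : ZMod 2} (hp : IsCorner s p) (hq : IsCorner s q)
    (hpi : p ∈ side C R i) (hqC : q ∉ C) : q ∈ side C R i := by
  have adj : ∀ {u v}, u ∈ side C R i → v ∉ C → FourAdj u v → v ∈ side C R i := fun hu hv h =>
    ⟨hv, (colour_eq_of_fourAdj hC hR hu.1 hv h).symm.trans hu.2⟩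
  -- Opposite corners are linked through either of the remaining two, `m` and `m'`; these form the
  -- other diagonal, so at least one is off the curve.
  have via : ∀ {u m m' v}, u ∈ side C R i → v ∉ C → FourAdj u m → FourAdj m v → FourAdj u m' →
      FourAdj m' v → ¬ (m ∈ C ∧ m' ∈ C) → v ∈ side C R i := by
    intro u m m' v hu hv h1 h2 h3 h4 h5
    by_cases hm : m ∈ C
    · exact adj (adj hu (fun hm' => h5 ⟨hm, hm'⟩) h3) hv h4
    · exact adj (adj hu hm h1) hv h2
  simp only [HasOppositeCorners, not_or] at h
  obtain ⟨hd, ha⟩ := h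
  obtain ⟨x, y⟩ := s
  rcases hp with rfl | rfl | rfl | rfl <;> rcases hq with rfl | rfl | rfl | rfl
  · exact hpi
  · exact adj hpi hqC (by simp [FourAdj])
  · exact adj hpi hqC (by simp [FourAdj])
  · exact via hpi hqC (by simp [FourAdj]) (by simp [FourAdj]) (by simp [FourAdj])
      (by simp [FourAdj]) ha
  · exact adj hpi hqC (by simp [FourAdj])
  · exact hpi
  · exact via hpi hqC (by simp [FourAdj]) (by simp [FourAdj]) (by simp [FourAdj])
      (by simp [FourAdj]) hd
  · exact adj hpi hqC (by simp [FourAdj])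
  · exact adj hpi hqC (by simp [FourAdj])
  · exact via hpi hqC (by simp [FourAdj]) (by simp [FourAdj]) (by simp [FourAdj])
      (by simp [FourAdj]) hd
  · exact hpi
  · exact adj hpi hqC (by simp [FourAdj])
  · exact via hpi hqC (by simp [FourAdj]) (by simp [FourAdj]) (by simp [FourAdj])
      (by simp [FourAdj]) ha
  · exact adj hpi hqC (by simp [FourAdj])
  · exact adj hpi hqC (by simp [FourAdj])
  · exact hpi

/-- Along a horizontal or vertical step of the curve, each side runs along both end points. -/
theorem exists_fourJoined_of_step (hC : IsEightCurve C) (hR : ∀ p ∈ C, p.1 ≤ R) {c d : ℤ × ℤ}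
    (hc : c ∈ C) (hd : d ∈ C) (h : FourAdj c d) (i : ZMod 2) :
    ∃ p ∈ side C R i, ∃ q ∈ side C R i, FourAdj c p ∧ FourAdj d q ∧ FourJoined C p q := by
  have notC : ∀ s r p q, p ∈ C → q ∈ C → IsCorner s r → IsCorner s p → IsCorner s q → p ≠ q →
      r ≠ p → r ≠ q → r ∉ C := by
    intro s r p q hp hq h1 h2 h3 n1 n2 n3 hr
    rcases hC.corners s _ _ _ h1 h2 h3 hr hp hq with h | h | h
    exacts [n2 h, n3 h, n1 h]
  have build : ∀ {c d p q}, p ∈ side C R i → q ∉ C → FourAdj c p → FourAdj d q → FourAdj p q →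
      ∃ p ∈ side C R i, ∃ q ∈ side C R i, FourAdj c p ∧ FourAdj d q ∧ FourJoined C p q := by
    intro c d p q hp hq h1 h2 h3
    have hj := fourJoined_of_fourAdj hp.1 hq h3
    exact ⟨p, hp, q, hj.mem_side hC hR hp, h1, h2, hj⟩
  have east : ∀ x y, (x, y) ∈ C → (x + 1, y) ∈ C →
      ∃ p ∈ side C R i, ∃ q ∈ side C R i, FourAdj (x, y) p ∧ FourAdj (x + 1, y) q ∧
        FourJoined C p q := by
    intro x y h1 h2
    -- The squares above and below the step have no further corner on the curve, so both flanks are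
    -- free; their colours differ by one, hence one of them has colour `i`.
    have n1 : (x, y + 1) ∉ C := by apply notC (x, y) _ _ _ h1 h2 <;> simp [IsCorner]
    have n2 : (x + 1, y + 1) ∉ C := by apply notC (x, y) _ _ _ h1 h2 <;> simp [IsCorner]
    have n3 : (x, y - 1) ∉ C := by apply notC (x, y - 1) _ _ _ h1 h2 <;> simp [IsCorner]
    have n4 : (x + 1, y - 1) ∉ C := by apply notC (x, y - 1) _ _ _ h1 h2 <;> simp [IsCorner]
    have k1 := colour_north hC hR h1 n1
    have k2 := colour_south hC hR h1 n3
    rw [ind_eq_zero.2 n2, add_zero] at k1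
    rw [ind_eq_zero.2 n4, ind_of_mem h2, add_zero] at k2
    rcases eq_or_eq_add_one i (colour C R (x, y)) with e | e
    · exact build ⟨n1, k1.trans e.symm⟩ n2 (by simp [FourAdj]) (by simp [FourAdj])
        (by simp [FourAdj])
    · exact build ⟨n3, k2.trans e.symm⟩ n4 (by simp [FourAdj]) (by simp [FourAdj])
        (by simp [FourAdj])
  have north : ∀ x y, (x, y) ∈ C → (x, y + 1) ∈ C →
      ∃ p ∈ side C R i, ∃ q ∈ side C R i, FourAdj (x, y) p ∧ FourAdj (x, y + 1) q ∧
        FourJoined C p q := by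
    intro x y h1 h2
    have n1 : (x + 1, y) ∉ C := by apply notC (x, y) _ _ _ h1 h2 <;> simp [IsCorner]
    have n2 : (x + 1, y + 1) ∉ C := by apply notC (x, y) _ _ _ h1 h2 <;> simp [IsCorner]
    have n3 : (x - 1, y) ∉ C := by apply notC (x - 1, y) _ _ _ h1 h2 <;> simp [IsCorner]
    have n4 : (x - 1, y + 1) ∉ C := by apply notC (x - 1, y) _ _ _ h1 h2 <;> simp [IsCorner]
    have k1 := colour_east hR n1
    have k2 := colour_west hR h1
    rw [ind_eq_zero.2 n2, ind_eq_zero.2 n4, ind_of_mem h2, add_zero, zero_add] at k2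
    rcases eq_or_eq_add_one i (colour C R (x, y)) with e | e
    · exact build ⟨n1, k1.trans e.symm⟩ n2 (by simp [FourAdj]) (by simp [FourAdj])
        (by simp [FourAdj])
    · exact build ⟨n3, k2.trans e.symm⟩ n4 (by simp [FourAdj]) (by simp [FourAdj])
        (by simp [FourAdj])
  obtain ⟨x, y⟩ := c
  rcases h with rfl | rfl | rfl | rfl
  · exact east x y hc hd
  · obtain ⟨p, hp, q, hq, h1, h2, h3⟩ := east (x - 1) y hd (by simpa using hc)
    exact ⟨q, hq, p, hp, by simpa using h2, h1, h3.symm⟩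
  · exact north x y hc hd
  · obtain ⟨p, hp, q, hq, h1, h2, h3⟩ := north x (y - 1) hd (by simpa using hc)
    exact ⟨q, hq, p, hp, by simpa using h2, h1, h3.symm⟩

/-- From any point off the curve one reaches the curve by a 4-path off the curve. -/
theorem exists_fourJoined_fourAdj {c p : ℤ × ℤ} (hc : c ∈ C) (hp : p ∉ C) :
    ∃ q ∉ C, ∃ d ∈ C, FourJoined C p q ∧ FourAdj d q := by
  induction hn : (p.1 - c.1).natAbs + (p.2 - c.2).natAbs using Nat.strong_induction_on
    generalizing p with
  | _ n ih =>
    obtain ⟨r, hr, hlt⟩ : ∃ r, FourAdj p r ∧ (r.1 - c.1).natAbs + (r.2 - c.2).natAbs < n := by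
      have hne : p.1 ≠ c.1 ∨ p.2 ≠ c.2 := by
        by_contra! hcon
        exact hp (Prod.ext hcon.1 hcon.2 ▸ hc)
      rcases lt_trichotomy p.1 c.1 with h | h | h
      · exact ⟨(p.1 + 1, p.2), by simp [FourAdj], by dsimp only; omega⟩
      · rcases lt_or_gt_of_ne (hne.resolve_left (not_not.2 h)) with h | h
        · exact ⟨(p.1, p.2 + 1), by simp [FourAdj], by dsimp only; omega⟩
        · exact ⟨(p.1, p.2 - 1), by simp [FourAdj], by dsimp only; omega⟩
      · exact ⟨(p.1 - 1, p.2), by simp [FourAdj], by dsimp only; omega⟩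
    by_cases hrC : r ∈ C
    · exact ⟨p, hp, r, hrC, .refl, hr.symm⟩
    · obtain ⟨q, hq, d, hd, h1, h2⟩ := ih _ hlt hrC rfl
      exact ⟨q, hq, d, hd, (fourJoined_of_fourAdj hp hrC hr).trans h1, h2⟩

end Sides

/-- If the complement of `C` is the disjoint union of two nonempty sets, not 4-adjacent to each other,
in each of which any two points are joined off `C`, then these are the 4-components. -/
theorem fourComponents_compl_eq_pair {C A B : Set (ℤ × ℤ)} (hA : A.Nonempty) (hB : B.Nonempty)
    (hunion : A ∪ B = Cᶜ) (hdisj : Disjoint A B) (hadj : ∀ p ∈ A, ∀ q ∈ B, ¬ FourAdj p q)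
    (hjA : ∀ p ∈ A, ∀ q ∈ A, FourJoined C p q) (hjB : ∀ p ∈ B, ∀ q ∈ B, FourJoined C p q) :
    fourComponents Cᶜ = {A, B} := by
  have split : ∀ T ⊆ Cᶜ, FourConnected T → T ⊆ A ∨ T ⊆ B := by
    intro T hT hconn
    by_contra! hcon
    obtain ⟨⟨q, hq, hqA⟩, ⟨p, hp, hpB⟩⟩ := hcon.imp not_subset.1 not_subset.1
    rw [← hunion] at hT
    refine hconn ⟨T ∩ A, T ∩ B, ⟨p, hp, (hT hp).resolve_right hpB⟩,
      ⟨q, hq, (hT hq).resolve_left hqA⟩, hdisj.mono inter_subset_right inter_subset_right, ?_,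
      fun p hp q hq => hadj p hp.2 q hq.2⟩
    rw [← inter_union_distrib_left, inter_eq_left.2 hT]
  have conn : ∀ A B : Set (ℤ × ℤ), A ∪ B = Cᶜ → (∀ p ∈ A, ∀ q ∈ B, ¬ FourAdj p q) →
      (∀ p ∈ A, ∀ q ∈ A, FourJoined C p q) → FourConnected A := by
    rintro A B hunion hadj hj ⟨P, Q, ⟨p, hp⟩, ⟨q, hq⟩, hPQ, rfl, hno⟩
    have hstay : ∀ r, FourJoined C p r → r ∈ P := by
      intro r hr
      induction hr with
      | refl => exact hp
      | @tail u v _ h ih =>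
        have hv : v ∈ (P ∪ Q) ∪ B := hunion ▸ h.2.1
        rcases hv with (hv | hv) | hv
        · exact hv
        · exact absurd h.2.2 (hno u ih v hv)
        · exact absurd h.2.2 (hadj u (Or.inl ih) v hv)
    exact disjoint_left.1 hPQ (hstay q (hj p (Or.inl hp) q (Or.inr hq))) hq
  have hAC : A ⊆ Cᶜ := hunion ▸ subset_union_left
  have hBC : B ⊆ Cᶜ := hunion ▸ subset_union_right
  have cA := conn A B hunion hadj hjA
  have cB := conn B A (by rw [union_comm, hunion]) (fun p hp q hq h => hadj q hq p hp h.symm) hjB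
  ext T
  constructor
  · intro hT
    have hT : Maximal (fun T => T ⊆ Cᶜ ∧ FourConnected T) T := hT
    rcases split T hT.prop.1 hT.prop.2 with h | h
    · exact Or.inl (hT.eq_of_le ⟨hAC, cA⟩ h)
    · exact Or.inr (hT.eq_of_le ⟨hBC, cB⟩ h)
  · rintro (rfl | rfl)
    · refine ⟨⟨hAC, cA⟩, fun S hS hle => ?_⟩
      refine (split S hS.1 hS.2).resolve_right fun h => ?_
      obtain ⟨p, hp⟩ := hA
      exact disjoint_left.1 hdisj hp (h (hle hp))
    · refine ⟨⟨hBC, cB⟩, fun S hS hle => ?_⟩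
      refine (split S hS.1 hS.2).resolve_left fun h => ?_
      obtain ⟨p, hp⟩ := hB
      exact disjoint_left.1 hdisj (h (hle hp)) hp

end DigitalTopology

/-! ### From the Jordan curve to its lattice trace. -/

namespace DigitalTopology

section Curve

variable {J : Set DigitalPlane}

theorem squareCentre_mem_iff (hstar : slantStar (slant ⁻¹' J) = J) {s : ℤ × ℤ} :
    squareCentre s ∈ J ↔ HasOppositeCorners (slant ⁻¹' J) s := by
  rw [← squareCentre_mem_slantStar, hstar]

theorem hasOppositeCorners_of_three {C : Set (ℤ × ℤ)} {s p q r : ℤ × ℤ} (hp : IsCorner s p)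
    (hq : IsCorner s q) (hr : IsCorner s r) (hpC : p ∈ C) (hqC : q ∈ C) (hrC : r ∈ C)
    (hpq : p ≠ q) (hpr : p ≠ r) (hqr : q ≠ r) : HasOppositeCorners C s := by
  rcases hp with rfl | rfl | rfl | rfl <;> rcases hq with rfl | rfl | rfl | rfl <;>
    first
    | exact absurd rfl hpq
    | exact Or.inl ⟨‹_›, ‹_›⟩
    | exact Or.inr ⟨‹_›, ‹_›⟩
    | rcases hr with rfl | rfl | rfl | rfl <;>
        first
        | exact absurd rfl hpr
        | exact absurd rfl hqr
        | exact Or.inl ⟨‹_›, ‹_›⟩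
        | exact Or.inr ⟨‹_›, ‹_›⟩

theorem fourAdj_of_three_corners {s p q r : ℤ × ℤ} (hp : IsCorner s p) (hq : IsCorner s q)
    (hr : IsCorner s r) (hpq : p ≠ q) (hpr : p ≠ r) (hqr : q ≠ r) : FourAdj p q ∨ FourAdj p r := by
  obtain ⟨x, y⟩ := s
  rcases hp with rfl | rfl | rfl | rfl <;> rcases hq with rfl | rfl | rfl | rfl <;>
    first
    | exact absurd rfl hpq
    | (left; simp [FourAdj]; done)
    | rcases hr with rfl | rfl | rfl | rfl <;>
        first
        | exact absurd rfl hpr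
        | exact absurd rfl hqr
        | (right; simp [FourAdj])

/-- Among three corners two are opposite, which puts the centre on `J`, and two are 4-adjacent,
which form a forbidden triangle with the centre. -/
theorem preimage_corners (hJ : IsJordanCurve J) (hcard : 4 < J.encard)
    (hstar : slantStar (slant ⁻¹' J) = J) {s p q r : ℤ × ℤ} (hp : IsCorner s p)
    (hq : IsCorner s q) (hr : IsCorner s r) (hpJ : slant p ∈ J) (hqJ : slant q ∈ J)
    (hrJ : slant r ∈ J) : p = q ∨ p = r ∨ q = r := by
  by_contra! hne
  have hs : squareCentre s ∈ J := (squareCentre_mem_iff hstar).2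
    (hasOppositeCorners_of_three (C := slant ⁻¹' J) hp hq hr hpJ hqJ hrJ hne.1 hne.2.1 hne.2.2)
  have key : ∀ {u v}, IsCorner s u → IsCorner s v → slant u ∈ J → slant v ∈ J → ¬ FourAdj u v :=
    fun hu hv huJ hvJ h => hJ.not_triangle hcard hs huJ hvJ
      (slant_mem_adjacency_squareCentre.2 hu) (slant_mem_adjacency_squareCentre.2 hv)
      (slant_mem_adjacency_slant.2 h)
  exact (fourAdj_of_three_corners hp hq hr hne.1 hne.2.1 hne.2.2).elim (key hp hq hpJ hqJ)
    (key hp hr hpJ hrJ)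

/-- The eight lattice points around `(x, y)`. -/
def eightRing (x y : ℤ) : Fin 8 → ℤ × ℤ :=
  ![(x + 1, y), (x + 1, y + 1), (x, y + 1), (x - 1, y + 1), (x - 1, y), (x - 1, y - 1),
    (x, y - 1), (x + 1, y - 1)]

/-- The eight points of the digital plane adjacent to `slant (x, y)`, in the order of `eightRing x y`. -/
def slantRing (x y : ℤ) : Fin 8 → DigitalPlane :=
  ![slant (x + 1, y), squareCentre (x, y), slant (x, y + 1), squareCentre (x - 1, y),
    slant (x - 1, y), squareCentre (x - 1, y - 1), slant (x, y - 1), squareCentre (x, y - 1)]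

theorem slantRing_injective (x y : ℤ) : Function.Injective (slantRing x y) := by
  -- In terms of integer offsets from the centre, injectivity is a finite check.
  have h : ∀ k, slantRing x y k = (DigitalLine.ofInt (x + y + ![1, 1, 1, 0, -1, -1, -1, 0] k),
      DigitalLine.ofInt (y - x + ![-1, 0, 1, 1, 1, 0, -1, -1] k)) := by
    intro k
    fin_cases k <;> simp [slantRing, slant, squareCentre] <;> omega
  intro i j hij
  rw [h, h, Prod.mk.injEq, DigitalLine.ofInt.apply_eq_iff_eq, DigitalLine.ofInt.apply_eq_iff_eq,
    add_right_inj, add_right_inj] at hij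
  revert i j
  decide

theorem adjacency_slant (x y : ℤ) : adjacency (slant (x, y)) = range (slantRing x y) := by
  ext z
  constructor
  · intro hz
    rcases eq_slant_or_eq_squareCentre z with ⟨q, rfl⟩ | ⟨⟨a, b⟩, rfl⟩
    · rcases slant_mem_adjacency_slant.1 hz with rfl | rfl | rfl | rfl
      exacts [⟨0, rfl⟩, ⟨4, rfl⟩, ⟨2, rfl⟩, ⟨6, rfl⟩]
    · have hs := squareCentre_mem_adjacency_slant.1 hz
      simp only [IsCorner, Prod.mk.injEq] at hs
      rcases hs with ⟨rfl, rfl⟩ | ⟨rfl, rfl⟩ | ⟨rfl, rfl⟩ | ⟨rfl, rfl⟩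
      · exact ⟨1, rfl⟩
      · exact ⟨3, by simp [slantRing]⟩
      · exact ⟨7, by simp [slantRing]⟩
      · exact ⟨5, by simp [slantRing]⟩
  · rintro ⟨k, rfl⟩
    fin_cases k
    · exact slant_mem_adjacency_slant.2 (by simp [FourAdj])
    · exact squareCentre_mem_adjacency_slant.2 (by simp [IsCorner])
    · exact slant_mem_adjacency_slant.2 (by simp [FourAdj])
    · exact squareCentre_mem_adjacency_slant.2 (by simp [IsCorner])
    · exact slant_mem_adjacency_slant.2 (by simp [FourAdj])
    · exact squareCentre_mem_adjacency_slant.2 (by simp [IsCorner])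
    · exact slant_mem_adjacency_slant.2 (by simp [FourAdj])
    · exact squareCentre_mem_adjacency_slant.2 (by simp [IsCorner])

/-- A mixed neighbour lies on `J` iff a diagonal of its square does. The diagonal avoiding `(x, y)`
is excluded, since it would give three corners; the other one ends at the matching diagonal
8-neighbour. Neighbours in `J` thus match 8-neighbours in the trace. -/
theorem slantRing_mem_iff (hJ : IsJordanCurve J) (hcard : 4 < J.encard)
    (hstar : slantStar (slant ⁻¹' J) = J) {x y : ℤ} (hp : slant (x, y) ∈ J) (k : Fin 8) :
    slantRing x y k ∈ J ↔ eightRing x y k ∈ slant ⁻¹' J := by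
  have opposite : ∀ s p q, IsCorner s (x, y) → IsCorner s p → IsCorner s q → p ≠ (x, y) →
      q ≠ (x, y) → p ≠ q → (slant p ∈ J ∧ slant q ∈ J ↔ False) := by
    intro s p q h1 h2 h3 n1 n2 n3
    refine iff_false_intro fun hcon => ?_
    rcases preimage_corners hJ hcard hstar h1 h2 h3 hp hcon.1 hcon.2 with h | h | h
    exacts [n1 h.symm, n2 h.symm, n3 h]
  rw [mem_preimage]
  fin_cases k
  · simp [slantRing, eightRing]
  · have h := opposite (x, y) (x + 1, y) (x, y + 1) (by simp [IsCorner]) (by simp [IsCorner])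
      (by simp [IsCorner]) (by simp) (by simp) (by simp)
    simp [slantRing, eightRing, squareCentre_mem_iff hstar, HasOppositeCorners, h, hp,
      -not_and]
  · simp [slantRing, eightRing]
  · have h := opposite (x - 1, y) (x - 1, y) (x, y + 1) (by simp [IsCorner]) (by simp [IsCorner])
      (by simp [IsCorner]) (by simp) (by simp) (by simp)
    simp [slantRing, eightRing, squareCentre_mem_iff hstar, HasOppositeCorners, h, hp, -not_and]
  · simp [slantRing, eightRing]
  · have h := opposite (x - 1, y - 1) (x, y - 1) (x - 1, y) (by simp [IsCorner])
      (by simp [IsCorner]) (by simp [IsCorner]) (by simp) (by simp) (by simp)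
    simp [slantRing, eightRing, squareCentre_mem_iff hstar, HasOppositeCorners, h, hp, -not_and]
  · simp [slantRing, eightRing]
  · have h := opposite (x, y - 1) (x, y - 1) (x + 1, y) (by simp [IsCorner]) (by simp [IsCorner])
      (by simp [IsCorner]) (by simp) (by simp) (by simp)
    simp [slantRing, eightRing, squareCentre_mem_iff hstar, HasOppositeCorners, h, hp, -not_and]

theorem encard_eightRing (C : Set (ℤ × ℤ)) (x y : ℤ) :
    {k | eightRing x y k ∈ C}.encard = ringCount C (x, y) := by
  classical
  have hval : ∀ (q : ℤ × ℤ) [Decidable (q ∈ C)],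
      (if q ∈ C then 1 else 0) = (ind C q).val := by
    intro q _
    split_ifs with h
    · rw [ind_of_mem h]
      rfl
    · rw [ind_eq_zero.2 h]
      rfl
  have hset : {k | eightRing x y k ∈ C} = ↑(Finset.univ.filter fun k => eightRing x y k ∈ C) := by
    simp
  rw [hset, encard_coe_eq_coe_finsetCard, Finset.card_filter, Fin.sum_univ_eight]
  simp only [hval]
  simp [ringCount, eightRing]

theorem ringCount_preimage (hJ : IsJordanCurve J) (hcard : 4 < J.encard)
    (hstar : slantStar (slant ⁻¹' J) = J) {p : ℤ × ℤ} (hp : slant p ∈ J) :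
    ringCount (slant ⁻¹' J) p = 2 := by
  obtain ⟨x, y⟩ := p
  have hmem := slantRing_mem_iff hJ hcard hstar hp
  have himage : adjacency (slant (x, y)) ∩ J =
      slantRing x y '' {k | eightRing x y k ∈ slant ⁻¹' J} := by
    rw [adjacency_slant]
    ext z
    constructor
    · rintro ⟨⟨k, rfl⟩, hk⟩
      exact ⟨k, (hmem k).1 hk, rfl⟩
    · rintro ⟨k, hk, rfl⟩
      exact ⟨⟨k, rfl⟩, (hmem k).2 hk⟩
  have hcount := hJ.encard_adjacency_inter hcard hp
  rw [himage, (slantRing_injective x y).encard_image, encard_eightRing] at hcount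
  exact_mod_cast hcount

theorem isEightCurve_preimage (hJ : IsJordanCurve J) (hcard : 4 < J.encard)
    (hstar : slantStar (slant ⁻¹' J) = J) : IsEightCurve (slant ⁻¹' J) where
  finite := hJ.finite.preimage slant_injective.injOn
  ringCount_eq_two _ hp := ringCount_preimage hJ hcard hstar hp
  corners _ _ _ _ h1 h2 h3 h4 h5 h6 := preimage_corners hJ hcard hstar h1 h2 h3 h4 h5 h6

/-- The curve corners of such a square are exactly one diagonal and the free corners exactly the
other. -/
theorem fourAdj_of_isCorner_of_notMem {C : Set (ℤ × ℤ)} {s c q : ℤ × ℤ} (hC : IsEightCurve C)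
    (h : HasOppositeCorners C s) (hc : IsCorner s c) (hq : IsCorner s q) (hcC : c ∈ C) (hqC : q ∉ C) :
    FourAdj c q := by
  obtain ⟨x, y⟩ := s
  rcases h with ⟨h, h'⟩ | ⟨h, h'⟩
  · obtain ⟨n1, n2⟩ := hC.notMem_of_diag h h'
    rcases hc with rfl | rfl | rfl | rfl <;> rcases hq with rfl | rfl | rfl | rfl <;>
      simp_all [FourAdj]
  · obtain ⟨n1, n2⟩ := hC.notMem_of_antidiag h h'
    rcases hc with rfl | rfl | rfl | rfl <;> rcases hq with rfl | rfl | rfl | rfl <;>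
      simp_all [FourAdj]

/-- Any two points on the same side of the curve are joined by a 4-path off the curve. -/
theorem fourJoined_of_mem_side (hJ : IsJordanCurve J) (hC : IsEightCurve (slant ⁻¹' J))
    (hstar : slantStar (slant ⁻¹' J) = J) {R : ℤ} (hR : ∀ p ∈ slant ⁻¹' J, p.1 ≤ R) {i : ZMod 2}
    {p q : ℤ × ℤ} (hp : p ∈ side (slant ⁻¹' J) R i) (hq : q ∈ side (slant ⁻¹' J) R i)
    {c₀ : ℤ × ℤ} (hc₀ : slant c₀ ∈ J) : FourJoined (slant ⁻¹' J) p q := by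
  obtain ⟨p₁, hp₁, c, hc, hj, hcp⟩ := exists_fourJoined_fourAdj (C := slant ⁻¹' J) hc₀ hp.1
  obtain ⟨q₁, hq₁, d, hd, hj', hdq⟩ := exists_fourJoined_fourAdj (C := slant ⁻¹' J) hc₀ hq.1
  have hp₁ := hj.mem_side hC hR hp
  have hq₁ := hj'.mem_side hC hR hq
  refine hj.trans (FourJoined.trans (FourJoined.symm ?_) hj'.symm)
  have hring : ∀ {c u v}, slant c ∈ J → u ∈ side (slant ⁻¹' J) R i → v ∈ side (slant ⁻¹' J) R i →
      FourAdj c u → FourAdj c v → FourJoined (slant ⁻¹' J) u v := fun hc hu hv h h' =>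
    fourJoined_of_colour_eq hC hR hc hu.1 hv.1 h h' (hu.2.trans hv.2.symm)
  -- The predicate carried along `J` says that all pure points of side `i` adjacent to the current
  -- point are joined to `p₁`. Pure to pure uses the flank of the step; passing through a mixed
  -- point uses that the free corners of its square are 4-neighbours of both curve corners.
  refine IsPreconnected.of_adjacency_invariant hJ.1.isPreconnected (x := slant c) (y := slant d)
    (Q := fun x => ∀ r ∈ side (slant ⁻¹' J) R i, slant r ∈ adjacency x →
      FourJoined (slant ⁻¹' J) r p₁) ?_ hc hd ?_ q₁ hq₁ (slant_mem_adjacency_slant.2 hdq)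
  · intro x hx y hy hxy hQ r hr hyr
    rcases eq_slant_or_eq_squareCentre x with ⟨u, rfl⟩ | ⟨s, rfl⟩ <;>
      rcases eq_slant_or_eq_squareCentre y with ⟨v, rfl⟩ | ⟨t, rfl⟩
    · rw [slant_mem_adjacency_slant] at hxy hyr
      obtain ⟨a, ha, b, hb, hua, hvb, hab⟩ := exists_fourJoined_of_step hC hR hx hy hxy i
      exact (hring hy hr hb hyr hvb).trans
        (hab.symm.trans (hQ a ha (slant_mem_adjacency_slant.2 hua)))
    · rw [squareCentre_mem_adjacency_slant] at hxy
      rw [slant_mem_adjacency_squareCentre] at hyr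
      exact hQ r hr (slant_mem_adjacency_slant.2
        (fourAdj_of_isCorner_of_notMem hC ((squareCentre_mem_iff hstar).1 hy) hxy hyr hx hr.1))
    · rw [slant_mem_adjacency_squareCentre] at hxy
      rw [slant_mem_adjacency_slant] at hyr
      have hs := (squareCentre_mem_iff hstar).1 hx
      obtain ⟨a, ha, hsa⟩ := exists_corner_mem_side hC hR hs i
      have hva := fourAdj_of_isCorner_of_notMem hC hs hxy hsa hy ha.1
      exact (hring hy hr ha hyr hva).trans (hQ a ha (slant_mem_adjacency_squareCentre.2 hsa))
    · exact absurd hxy squareCentre_notMem_adjacency_squareCentre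
  · intro r hr hcr
    exact hring hc hr hp₁ (slant_mem_adjacency_slant.1 hcr) hcp

theorem exists_slant_mem (hstar : slantStar (slant ⁻¹' J) = J) (hJ : J.Nonempty) :
    ∃ c, slant c ∈ J := by
  obtain ⟨x, hx⟩ := hJ
  rcases eq_slant_or_eq_squareCentre x with ⟨p, rfl⟩ | ⟨s, rfl⟩
  · exact ⟨p, hx⟩
  · rcases (squareCentre_mem_iff hstar).1 hx with h | h
    · exact ⟨_, h.1⟩
    · exact ⟨_, h.1⟩

/-! ### The two regions of the digital plane. -/

/-- The part of the digital plane belonging to the side `i` of the curve. -/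
def region (J : Set DigitalPlane) (R : ℤ) (i : ZMod 2) : Set DigitalPlane :=
  slantStar (side (slant ⁻¹' J) R i) ∪ mixedFill (side (slant ⁻¹' J) R i) J

theorem slant_mem_region {R : ℤ} {i : ZMod 2} {p : ℤ × ℤ} :
    slant p ∈ region J R i ↔ p ∈ side (slant ⁻¹' J) R i := by
  rw [region, mem_union, or_iff_left slant_notMem_mixedFill, slant_mem_slantStar]

/-- If the centre is on `J`, its square has free corners of both colours, which rules out both
`slantStar` and `mixedFill`. If it is off `J`, all free corners share a colour, so one corner of
side `i` already forces `mixedFill`. -/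
theorem squareCentre_mem_region (hC : IsEightCurve (slant ⁻¹' J))
    (hstar : slantStar (slant ⁻¹' J) = J) {R : ℤ} (hR : ∀ p ∈ slant ⁻¹' J, p.1 ≤ R) {i : ZMod 2}
    {s : ℤ × ℤ} : squareCentre s ∈ region J R i ↔
      squareCentre s ∉ J ∧ ∃ p ∈ side (slant ⁻¹' J) R i, IsCorner s p := by
  rw [region, mem_union, squareCentre_mem_slantStar, squareCentre_mem_mixedFill,
    squareCentre_mem_iff hstar]
  constructor
  · rintro (h | h)
    · refine ⟨fun hs => not_hasOppositeCorners_side hC hR hs i h, ?_⟩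
      rcases h with h | h
      · exact ⟨_, h.1, by simp [IsCorner]⟩
      · exact ⟨_, h.1, by simp [IsCorner]⟩
    · have hs : ¬ HasOppositeCorners (slant ⁻¹' J) s := by
        intro hs
        obtain ⟨p, hp, hsp⟩ := exists_corner_mem_side hC hR hs (i + 1)
        rcases h p hsp with h | h
        · simpa using eq_of_mem_side hp h
        · exact hp.1 h
      refine ⟨hs, ?_⟩
      by_contra! hcon
      have hall : ∀ p, IsCorner s p → p ∈ slant ⁻¹' J := fun p hp =>
        (h p hp).resolve_left fun hi => hcon p hi hp
      exact hs (Or.inl ⟨hall _ (by simp [IsCorner]), hall _ (by simp [IsCorner])⟩)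
  · rintro ⟨hs, p, hp, hsp⟩
    refine Or.inr fun q hsq => ?_
    by_cases hq : q ∈ slant ⁻¹' J
    · exact Or.inr hq
    · exact Or.inl (mem_side_of_isCorner hC hR hs hsp hsq hp hq)

theorem region_union (hC : IsEightCurve (slant ⁻¹' J)) (hstar : slantStar (slant ⁻¹' J) = J)
    {R : ℤ} (hR : ∀ p ∈ slant ⁻¹' J, p.1 ≤ R) : region J R 0 ∪ region J R 1 = Jᶜ := by
  have hside : ∀ p, p ∈ side (slant ⁻¹' J) R 0 ∨ p ∈ side (slant ⁻¹' J) R 1 ↔ slant p ∉ J := by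
    intro p
    rw [← mem_union, side_zero_union_side_one]
    rfl
  ext x
  rw [mem_union, mem_compl_iff]
  rcases eq_slant_or_eq_squareCentre x with ⟨p, rfl⟩ | ⟨s, rfl⟩
  · rw [slant_mem_region, slant_mem_region, hside]
  · rw [squareCentre_mem_region hC hstar hR, squareCentre_mem_region hC hstar hR, ← and_or_left,
      and_iff_left_iff_imp]
    intro hs
    obtain ⟨p, hsp, hp⟩ : ∃ p, IsCorner s p ∧ slant p ∉ J := by
      by_contra! hcon
      exact hs ((squareCentre_mem_iff hstar).2
        (Or.inl ⟨hcon _ (by simp [IsCorner]), hcon _ (by simp [IsCorner])⟩))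
    exact ((hside p).2 hp).imp (fun h => ⟨p, h, hsp⟩) (fun h => ⟨p, h, hsp⟩)

theorem notMem_adjacency_of_mem_region (hC : IsEightCurve (slant ⁻¹' J))
    (hstar : slantStar (slant ⁻¹' J) = J) {R : ℤ} (hR : ∀ p ∈ slant ⁻¹' J, p.1 ≤ R)
    {i j : ZMod 2} (hij : i ≠ j) {x y : DigitalPlane} (hx : x ∈ region J R i)
    (hy : y ∈ region J R j) : y ∉ adjacency x := by
  have corner : ∀ {i j s p}, i ≠ j → squareCentre s ∈ region J R i → slant p ∈ region J R j →
      ¬ IsCorner s p := by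
    intro i j s p hij hs hp hsp
    rw [squareCentre_mem_region hC hstar hR, squareCentre_mem_iff hstar] at hs
    rw [slant_mem_region] at hp
    obtain ⟨hs, q, hq, hsq⟩ := hs
    exact hij (eq_of_mem_side (mem_side_of_isCorner hC hR hs hsq hsp hq hp.1) hp)
  intro hxy
  rcases eq_slant_or_eq_squareCentre x with ⟨p, rfl⟩ | ⟨s, rfl⟩ <;>
    rcases eq_slant_or_eq_squareCentre y with ⟨q, rfl⟩ | ⟨t, rfl⟩
  · rw [slant_mem_region] at hx hy
    exact hij (hx.2.symm.trans ((colour_eq_of_fourAdj hC hR hx.1 hy.1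
      (slant_mem_adjacency_slant.1 hxy)).trans hy.2))
  · exact corner hij.symm hy hx (squareCentre_mem_adjacency_slant.1 hxy)
  · exact corner hij hx hy (slant_mem_adjacency_squareCentre.1 hxy)
  · exact squareCentre_notMem_adjacency_squareCentre hxy

theorem disjoint_region (hC : IsEightCurve (slant ⁻¹' J))
    (hstar : slantStar (slant ⁻¹' J) = J) {R : ℤ} (hR : ∀ p ∈ slant ⁻¹' J, p.1 ≤ R)
    {i j : ZMod 2} (hij : i ≠ j) : Disjoint (region J R i) (region J R j) := by
  rw [disjoint_left]
  intro x hi hj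
  rcases eq_slant_or_eq_squareCentre x with ⟨p, rfl⟩ | ⟨s, rfl⟩
  · rw [slant_mem_region] at hi hj
    exact hij (eq_of_mem_side hi hj)
  · obtain ⟨p, hp, hsp⟩ := ((squareCentre_mem_region hC hstar hR).1 hi).2
    exact notMem_adjacency_of_mem_region hC hstar hR hij.symm hj (slant_mem_region.2 hp)
      (slant_mem_adjacency_squareCentre.2 hsp)

/-- Each mixed point of the region is adjacent to a pure point of it, and pure points are linked by
4-paths that stay on their side. -/
theorem isPreconnected_region (hC : IsEightCurve (slant ⁻¹' J))
    (hstar : slantStar (slant ⁻¹' J) = J) {R : ℤ} (hR : ∀ p ∈ slant ⁻¹' J, p.1 ≤ R) {i : ZMod 2}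
    (hjoin : ∀ p ∈ side (slant ⁻¹' J) R i, ∀ q ∈ side (slant ⁻¹' J) R i,
      FourJoined (slant ⁻¹' J) p q) : IsPreconnected (region J R i) := by
  refine isPreconnected_of_adjacency_invariant fun Q hQ x hx y hy hQx => ?_
  have hpure : ∀ z ∈ region J R i, ∃ p ∈ side (slant ⁻¹' J) R i, (Q z ↔ Q (slant p)) := by
    intro z hz
    rcases eq_slant_or_eq_squareCentre z with ⟨p, rfl⟩ | ⟨s, rfl⟩
    · exact ⟨p, slant_mem_region.1 hz, Iff.rfl⟩
    · obtain ⟨p, hp, hsp⟩ := ((squareCentre_mem_region hC hstar hR).1 hz).2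
      exact ⟨p, hp, hQ _ hz _ (slant_mem_region.2 hp) (slant_mem_adjacency_squareCentre.2 hsp),
        hQ _ (slant_mem_region.2 hp) _ hz (squareCentre_mem_adjacency_slant.2 hsp)⟩
  obtain ⟨p, hp, hxp⟩ := hpure x hx
  obtain ⟨q, hq, hyq⟩ := hpure y hy
  have hwalk : ∀ r, FourJoined (slant ⁻¹' J) p r → r ∈ side (slant ⁻¹' J) R i ∧ Q (slant r) := by
    intro r hr
    refine ⟨hr.mem_side hC hR hp, ?_⟩
    induction hr with
    | refl => exact hxp.1 hQx
    | tail h1 h2 ih =>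
      have h := FourJoined.mem_side hC hR h1 hp
      have h' := FourJoined.mem_side hC hR (fourJoined_of_fourAdj h2.1 h2.2.1 h2.2.2) h
      exact hQ _ (slant_mem_region.2 h) _ (slant_mem_region.2 h')
        (slant_mem_adjacency_slant.2 h2.2.2) ih
  exact hyq.2 (hwalk q (hjoin p hp q hq)).2

theorem adjacency_inter_region_nonempty (hC : IsEightCurve (slant ⁻¹' J))
    (hstar : slantStar (slant ⁻¹' J) = J) {R : ℤ} (hR : ∀ p ∈ slant ⁻¹' J, p.1 ≤ R)
    {x : DigitalPlane} (hx : x ∈ J) (i : ZMod 2) : (adjacency x ∩ region J R i).Nonempty := by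
  rcases eq_slant_or_eq_squareCentre x with ⟨p, rfl⟩ | ⟨s, rfl⟩
  · obtain ⟨q, hq, hpq⟩ := exists_fourAdj_mem_side hC hR hx i
    exact ⟨slant q, slant_mem_adjacency_slant.2 hpq, slant_mem_region.2 hq⟩
  · obtain ⟨q, hq, hsq⟩ := exists_corner_mem_side hC hR ((squareCentre_mem_iff hstar).1 hx) i
    exact ⟨slant q, slant_mem_adjacency_squareCentre.2 hsq, slant_mem_region.2 hq⟩

end Curve

end DigitalTopology

/-! ### Assembly: the two colours give the two components. -/

theorem mainTheorem6 (J : Set DigitalPlane)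
    (hJ : DigitalTopology.IsJordanCurve J)
    (hcard : 4 < J.encard)
    (hstar : DigitalTopology.slantStar (DigitalTopology.slant ⁻¹' J) = J) :
    (DigitalTopology.components Jᶜ).encard = 2 ∧
    (∀ x ∈ J, ∀ C ∈ DigitalTopology.components Jᶜ,
      (DigitalTopology.adjacency x ∩ C).Nonempty) ∧
    ∃ A B : Set (ℤ × ℤ), A ≠ B ∧
      DigitalTopology.fourComponents (DigitalTopology.slant ⁻¹' J)ᶜ = {A, B} ∧
      DigitalTopology.components Jᶜ =
        {DigitalTopology.slantStar A ∪ DigitalTopology.mixedFill A J,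
         DigitalTopology.slantStar B ∪ DigitalTopology.mixedFill B J} := by
  open DigitalTopology in
  have hC := isEightCurve_preimage hJ hcard hstar
  obtain ⟨R, hR⟩ : ∃ R : ℤ, ∀ p ∈ slant ⁻¹' J, p.1 ≤ R := by
    obtain ⟨R, hR⟩ := (hC.finite.image Prod.fst).bddAbove
    exact ⟨R, fun p hp => hR ⟨p, hp, rfl⟩⟩
  obtain ⟨c, hc⟩ := exists_slant_mem hstar hJ.1.nonempty
  have hne : ∀ i, (side (slant ⁻¹' J) R i).Nonempty := fun i =>
    let ⟨p, hp, _⟩ := exists_fourAdj_mem_side hC hR hc i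
    ⟨p, hp⟩
  have hjoin : ∀ i, ∀ p ∈ side (slant ⁻¹' J) R i, ∀ q ∈ side (slant ⁻¹' J) R i,
      FourJoined (slant ⁻¹' J) p q := fun i p hp q hq =>
    fourJoined_of_mem_side hJ hC hstar hR hp hq hc
  have hconn : ∀ i, IsConnected (region J R i) := fun i =>
    ⟨(hne i).elim fun p hp => ⟨slant p, slant_mem_region.2 hp⟩,
      isPreconnected_region hC hstar hR (hjoin i)⟩
  have hcomp : components Jᶜ = {region J R 0, region J R 1} :=
    components_eq_pair (hconn 0) (hconn 1) (region_union hC hstar hR)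
      (disjoint_region hC hstar hR zero_ne_one)
      fun x hx y hy => notMem_adjacency_of_mem_region hC hstar hR zero_ne_one hx hy
  have hdisj : Disjoint (side (slant ⁻¹' J) R 0) (side (slant ⁻¹' J) R 1) :=
    Set.disjoint_left.2 fun p h h' => zero_ne_one (eq_of_mem_side h h')
  refine ⟨?_, ?_, side (slant ⁻¹' J) R 0, side (slant ⁻¹' J) R 1, hdisj.ne (hne 0).ne_empty, ?_,
    hcomp⟩
  · rw [hcomp]
    exact Set.encard_pair ((disjoint_region hC hstar hR zero_ne_one).ne (hconn 0).nonempty.ne_empty)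
  · intro x hx D hD
    rw [hcomp] at hD
    rcases hD with rfl | rfl
    · exact adjacency_inter_region_nonempty hC hstar hR hx 0
    · exact adjacency_inter_region_nonempty hC hstar hR hx 1
  · refine fourComponents_compl_eq_pair (hne 0) (hne 1) side_zero_union_side_one hdisj ?_
      (hjoin 0) (hjoin 1)
    intro p hp q hq h
    exact zero_ne_one (eq_of_mem_side
      ((fourJoined_of_fourAdj hp.1 hq.1 h).mem_side hC hR hp) hq)
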